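/- Let $G=(V,E)$ be a finite simple graph. A complete bipartite induced subgraph $B$ of $G$ with (non-empty) sides $B_X,B_Y$ is called generating if there is an independent set $S$ of $G$ such that $S\cup B_X$ and $S\cup B_Y$ are both maximal independent sets of $G$; it then produces the constraint $w(B_X)=w(B_Y)$ on weight functions $w:V\to\mathbb{R}$, where $w(A)=\sum_{a\in A}w(a)$. For $v\in V$ let $L_v$ be the vector space of all $w:V\to\mathbb{R}$ that satisfy the constraints produced by all generating subgraphs $B$ of $G$ with $B_X=\{v\}$. Theorem. There is an algorithm (a fixed random access machine program) that, given a graph $G=(V,E)$ containing none of the cycles $C_4,C_5,C_6,C_7$ as a (not necessarily induced) subgraph and a vertex $v\in V$, finds $L_v$ in $O(|V|^2(|V|+|E|))$ steps in the following sense: it outputs, by listing their vertex sets $B_Y$, a family $F_v$ of at most $|V|$ generating subgraphs $B$ of $G$ with $B_X=\{v\}$ such that the constraint (as a linear form in $w$) of every generating subgraph $B$ with $B_X=\{v\}$ is a linear combination of the constraints of the members of $F_v$; consequently $L_v$ is exactly the space of weight functions that satisfy the constraints produced by the members of $F_v$. -/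

import Mathlib

/-! ### Generating subgraphs and the spaces of weight functions -/

/-- `S` is a maximal (with respect to inclusion) independent set of `G`. -/
def IsMaxIndep {V : Type*} (G : SimpleGraph V) (S : Set V) : Prop :=
  Maximal G.IsIndepSet S

/-- The vertex sets `X` and `Y` are the two sides of a complete bipartite induced subgraph
of `G`: both are non-empty and independent, and every vertex of `X` is adjacent to every
vertex of `Y` (so that they are disjoint). -/
def IsInducedBiclique {V : Type*} (G : SimpleGraph V) (X Y : Finset V) : Prop :=
  X.Nonempty ∧ Y.Nonempty ∧ G.IsIndepSet (X : Set V) ∧ G.IsIndepSet (Y : Set V) ∧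
    ∀ x ∈ X, ∀ y ∈ Y, G.Adj x y

/-- The complete bipartite induced subgraph of `G` with bipartition `(X, Y)` is generating. -/
def IsGenerating {V : Type*} (G : SimpleGraph V) (X Y : Finset V) : Prop :=
  IsInducedBiclique G X Y ∧
    ∃ S : Set V, G.IsIndepSet S ∧ IsMaxIndep G (S ∪ (X : Set V)) ∧ IsMaxIndep G (S ∪ (Y : Set V))

/-- The linear form `w ↦ w(X) - w(Y)`; a weight function satisfies the constraint produced by
the subgraph with bipartition `(X, Y)` if and only if this form vanishes at it. -/
def constraintForm {V : Type*} (B : Finset V × Finset V) : (V → ℝ) →ₗ[ℝ] ℝ :=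
  ∑ x ∈ B.1, LinearMap.proj x - ∑ y ∈ B.2, LinearMap.proj y

/-- The vector space of all weight functions `w` with `w(X) = w(Y)` for every pair `(X, Y)` in
the family `𝓕`. -/
def solutionSpace {V : Type*} (𝓕 : Set (Finset V × Finset V)) : Submodule ℝ (V → ℝ) where
  carrier := {w | ∀ B ∈ 𝓕, ∑ x ∈ B.1, w x = ∑ y ∈ B.2, w y}
  add_mem' := by
    intro a b ha hb B hB
    simp only [Pi.add_apply, Finset.sum_add_distrib, ha B hB, hb B hB]
  zero_mem' := by
    intro B _
    simp
  smul_mem' := by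
    intro c a ha B hB
    simp only [Pi.smul_apply, smul_eq_mul, ← Finset.mul_sum, ha B hB]

/-- All generating subgraphs `B` of `G` with `B_X = {v}`, as pairs `(B_X, B_Y)`. -/
def generatingAt {V : Type*} (G : SimpleGraph V) (v : V) : Set (Finset V × Finset V) :=
  {B | B.1 = {v} ∧ IsGenerating G B.1 B.2}

/-- The space `L_v`. -/
def spaceL {V : Type*} (G : SimpleGraph V) (v : V) : Submodule ℝ (V → ℝ) :=
  solutionSpace (generatingAt G v)

/-! ### The machine model

A random access machine with finitely many scalar registers and finitely many arrays of registers
in use, all of which hold natural numbers, programmed with assignments, tests and loops. The only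
arithmetic is successor and predecessor, so that in `t` steps no number grows by more than `t`
beyond the input numbers and the constants of the program. Every operation is charged one step. -/

/-- Expressions: a constant, the scalar register `x`, the entry of array `a` at an index,
successor and (truncated) predecessor. -/
inductive RamExp : Type
  | const (c : ℕ) : RamExp
  | var (x : ℕ) : RamExp
  | arr (a : ℕ) (i : RamExp) : RamExp
  | succ (e : RamExp) : RamExp
  | pred (e : RamExp) : RamExp

/-- Tests. -/
inductive RamTest : Type
  | eq (e f : RamExp) : RamTest
  | lt (e f : RamExp) : RamTest
  | not (b : RamTest) : RamTest
  | and (b c : RamTest) : RamTest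

/-- Programs. -/
inductive RamProg : Type
  | skip : RamProg
  | assign (x : ℕ) (e : RamExp) : RamProg
  | store (a : ℕ) (i e : RamExp) : RamProg
  | seq (p q : RamProg) : RamProg
  | cond (b : RamTest) (p q : RamProg) : RamProg
  | loop (b : RamTest) (p : RamProg) : RamProg

/-- The content of the memory. -/
structure RamState : Type where
  var : ℕ → ℕ
  arr : ℕ → ℕ → ℕ

/-- The value of an expression. -/
def RamExp.eval (s : RamState) : RamExp → ℕ
  | .const c => c
  | .var x => s.var x
  | .arr a i => s.arr a (i.eval s)
  | .succ e => e.eval s + 1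
  | .pred e => e.eval s - 1

/-- The number of steps that the evaluation of an expression takes. -/
def RamExp.cost : RamExp → ℕ
  | .const _ => 1
  | .var _ => 1
  | .arr _ i => i.cost + 1
  | .succ e => e.cost + 1
  | .pred e => e.cost + 1

/-- The truth of a test. -/
def RamTest.holds (s : RamState) : RamTest → Prop
  | .eq e f => e.eval s = f.eval s
  | .lt e f => e.eval s < f.eval s
  | .not b => ¬ b.holds s
  | .and b c => b.holds s ∧ c.holds s

/-- The number of steps that a test takes. -/
def RamTest.cost : RamTest → ℕ
  | .eq e f => e.cost + f.cost + 1
  | .lt e f => e.cost + f.cost + 1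
  | .not b => b.cost + 1
  | .and b c => b.cost + c.cost + 1

/-- The memory after `x := k`. -/
def RamState.setVar (s : RamState) (x k : ℕ) : RamState :=
  { s with var := Function.update s.var x k }

/-- The memory after `a[i] := k`. -/
def RamState.setArr (s : RamState) (a i k : ℕ) : RamState :=
  { s with arr := Function.update s.arr a (Function.update (s.arr a) i k) }

/-- `RamExec p s t s'`: started with memory `s`, the program `p` halts after exactly `t` steps,
with memory `s'`. -/
inductive RamExec : RamProg → RamState → ℕ → RamState → Prop
  | skip (s : RamState) : RamExec .skip s 1 s
  | assign (s : RamState) (x : ℕ) (e : RamExp) :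
      RamExec (.assign x e) s (e.cost + 1) (s.setVar x (e.eval s))
  | store (s : RamState) (a : ℕ) (i e : RamExp) :
      RamExec (.store a i e) s (i.cost + e.cost + 1) (s.setArr a (i.eval s) (e.eval s))
  | seq {p q : RamProg} {s s' s'' : RamState} {t t' : ℕ} :
      RamExec p s t s' → RamExec q s' t' s'' → RamExec (.seq p q) s (t + t') s''
  | cond_true {b : RamTest} {p q : RamProg} {s s' : RamState} {t : ℕ} :
      b.holds s → RamExec p s t s' → RamExec (.cond b p q) s (b.cost + 1 + t) s'
  | cond_false {b : RamTest} {p q : RamProg} {s s' : RamState} {t : ℕ} :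
      ¬ b.holds s → RamExec q s t s' → RamExec (.cond b p q) s (b.cost + 1 + t) s'
  | loop_stop {b : RamTest} {p : RamProg} {s : RamState} :
      ¬ b.holds s → RamExec (.loop b p) s (b.cost + 1) s
  | loop_step {b : RamTest} {p : RamProg} {s s' s'' : RamState} {t t' : ℕ} :
      b.holds s → RamExec p s t s' → RamExec (.loop b p) s' t' s'' →
      RamExec (.loop b p) s (b.cost + 1 + t + t') s''

/-! ### Input and output -/

/-- `es` lists every edge of `G` exactly once, in any order, with its ends in either order. -/
def ListsEdges {n : ℕ} (G : SimpleGraph (Fin n)) (es : List (Fin n × Fin n)) : Prop :=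
  (es.map fun p => s(p.1, p.2)).Nodup ∧
    ∀ e : Sym2 (Fin n), e ∈ G.edgeSet ↔ e ∈ es.map fun p => s(p.1, p.2)

/-- The initial memory: the scalar registers 0, 1, 2 hold the number of vertices, the number of
edges and the vertex `v`; the arrays 0 and 1 hold at index `k` the two ends of the `k`-th edge;
all the rest is 0. -/
def inputState {n : ℕ} (es : List (Fin n × Fin n)) (v : Fin n) : RamState where
  var x := if x = 0 then n else if x = 1 then es.length else if x = 2 then (v : ℕ) else 0
  arr a k :=
    if a = 0 then (es.map fun p => (p.1 : ℕ)).getD k 0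
    else if a = 1 then (es.map fun p => (p.2 : ℕ)).getD k 0
    else 0

/-- The memory `s` holds the list `F` of vertex sets as its output: the scalar register 0 holds the
length of `F`, and the vertices of the `i`-th set are the entries of array 1 at the indices `k`
with `ptr i ≤ k < ptr (i + 1)`, where `ptr` is array 0. -/
def HoldsOutput {n : ℕ} (s : RamState) (F : List (Finset (Fin n))) : Prop :=
  s.var 0 = F.length ∧
    ∀ (i : ℕ) (hi : i < F.length),
      s.arr 0 i ≤ s.arr 0 (i + 1) ∧
      (F[i]'hi).image (fun u : Fin n => (u : ℕ)) =
        (Finset.Ico (s.arr 0 i) (s.arr 0 (i + 1))).image (s.arr 1)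

/-! ### Short cycles -/

/-! Call the neighbours at distance 2 of a neighbour of `v` its children. Excluding `C_4` makes the
neighbourhood of `v` a disjoint union of single vertices and edges (`mate_unique`) and gives every
vertex at distance 2 a single parent (`parent_unique`). Excluding `C_5` gives adjacent vertices at
distance 2 the same parent (`parent_eq_of_adj`).

The main step characterises the sets `Y` for which `({v}, Y)` is generating: they are the non-empty
admissible ones (`isAdmissible_of_isGenerating`, `IsAdmissible.isGenerating`). In the set `S ∪ {v}`,
a child of a vertex of `Y` can be dominated only from distance 3, so a vertex with a child that has
no such neighbour is blocked. A neighbour of `v` outside `Y` must be dominated by its mate in `Y` or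
by a child in `S`. Conversely, the vertices needed at distances 2 and 3 can be chosen independently
of one another, since an edge between two of them would close a cycle of length 5, 6 or 7.

Admissibility is a condition on each component of the neighbourhood separately: choose one unblocked
vertex, or none if every vertex of the component has a child. Fix a base set, choosing the smallest
unblocked vertex wherever there is one. As the constraint form is additive over components, the form
of any admissible set is that of the base set plus, for each component where the two differ, the
effect of changing the base set there alone. So the base set and its one-component changes span
everything (`constraintForm_mem_span`). Charging the base set to `v`, dropping a base vertex to that
vertex, and a swap to the vertex swapped in bounds the family by the number of vertices.

Every property involved asks for a suitable neighbour, so one pass over the oriented edges computes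
it. A constant-time test then decides membership for each pair `(u, z)`. The total is `O(n² + m)`,
within the required bound. -/

theorem cycleGraph_isContained_of_injective {V : Type*} {G : SimpleGraph V} {k : ℕ}
    (f : Fin (k + 2) → V) (hf : Function.Injective f) (h : ∀ i, G.Adj (f i) (f (i + 1))) :
    (SimpleGraph.cycleGraph (k + 2)).IsContained G := by
  refine ⟨⟨⟨f, ?_⟩, hf⟩⟩
  intro a b hab
  rw [SimpleGraph.cycleGraph_adj] at hab
  rcases hab with hab | hab
  · have : a = b + 1 := by rw [← hab]; abel
    rw [this]; exact (h b).symm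
  · have : b = a + 1 := by rw [← hab]; abel
    rw [this]; exact h a

/-- `G` contains none of the cycles of lengths 4, 5, 6 and 7. -/
structure ShortCycleFree {V : Type*} (G : SimpleGraph V) : Prop where
  four : (SimpleGraph.cycleGraph 4).Free G
  five : (SimpleGraph.cycleGraph 5).Free G
  six : (SimpleGraph.cycleGraph 6).Free G
  seven : (SimpleGraph.cycleGraph 7).Free G

namespace ShortCycleFree

variable {V : Type*} {G : SimpleGraph V}

theorem not_c4 (h : ShortCycleFree G) {a b c d : V} (hab : G.Adj a b) (hbc : G.Adj b c)
    (hcd : G.Adj c d) (hda : G.Adj d a) (hac : a ≠ c) (hbd : b ≠ d) : False := by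
  refine h.four (cycleGraph_isContained_of_injective ![a, b, c, d] ?_ ?_)
  · have := hab.ne; have := hbc.ne; have := hcd.ne; have := hda.ne
    intro i j hij
    fin_cases i <;> fin_cases j <;> simp_all
  · intro i; fin_cases i <;> assumption

theorem not_c5 (h : ShortCycleFree G) {a b c d e : V} (hab : G.Adj a b) (hbc : G.Adj b c)
    (hcd : G.Adj c d) (hde : G.Adj d e) (hea : G.Adj e a) (hn : [a, b, c, d, e].Nodup) :
    False := by
  refine h.five (cycleGraph_isContained_of_injective [a, b, c, d, e].get
    (List.nodup_iff_injective_get.1 hn) ?_)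
  intro i; fin_cases i <;> assumption

theorem not_c6 (h : ShortCycleFree G) {a b c d e f : V} (hab : G.Adj a b) (hbc : G.Adj b c)
    (hcd : G.Adj c d) (hde : G.Adj d e) (hef : G.Adj e f) (hfa : G.Adj f a)
    (hn : [a, b, c, d, e, f].Nodup) : False := by
  refine h.six (cycleGraph_isContained_of_injective [a, b, c, d, e, f].get
    (List.nodup_iff_injective_get.1 hn) ?_)
  intro i; fin_cases i <;> assumption

theorem not_c7 (h : ShortCycleFree G) {a b c d e f g : V} (hab : G.Adj a b) (hbc : G.Adj b c)
    (hcd : G.Adj c d) (hde : G.Adj d e) (hef : G.Adj e f) (hfg : G.Adj f g) (hga : G.Adj g a)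
    (hn : [a, b, c, d, e, f, g].Nodup) : False := by
  refine h.seven (cycleGraph_isContained_of_injective [a, b, c, d, e, f, g].get
    (List.nodup_iff_injective_get.1 hn) ?_)
  intro i; fin_cases i <;> assumption

end ShortCycleFree

/-! ### Maximal independent sets -/

section MaxIndep

variable {V : Type*} {G : SimpleGraph V}

theorem SimpleGraph.IsIndepSet.not_adj {S : Set V} (h : G.IsIndepSet S) {a b : V} (ha : a ∈ S)
    (hb : b ∈ S) : ¬ G.Adj a b := fun hab => h ha hb hab.ne hab

theorem isMaxIndep_iff {S : Set V} :
    IsMaxIndep G S ↔ G.IsIndepSet S ∧ ∀ x, x ∉ S → ∃ s ∈ S, G.Adj x s := by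
  constructor
  · intro h
    refine ⟨h.prop, fun x hx => ?_⟩
    by_contra! hc
    have hi : G.IsIndepSet (insert x S) := by
      refine Set.pairwise_insert.2 ⟨h.prop, fun b hb _ => ⟨hc b hb, fun h' => hc b hb h'.symm⟩⟩
    exact hx (h.le_of_ge hi (Set.subset_insert x S) (Set.mem_insert x S))
  · rintro ⟨h1, h2⟩
    refine ⟨h1, fun T hT hST x hx => ?_⟩
    by_contra hxS
    obtain ⟨s, hs, hadj⟩ := h2 x hxS
    exact hT.not_adj hx (hST hs) hadj

theorem exists_isMaxIndep_superset [Finite V] {S : Set V} (h : G.IsIndepSet S) :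
    ∃ M, S ⊆ M ∧ IsMaxIndep G M :=
  (Set.toFinite {T : Set V | G.IsIndepSet T}).exists_le_maximal h

end MaxIndep

/-! ### The distance layers around a vertex -/

section Layers

variable {V : Type*} (G : SimpleGraph V) (v : V)

/-- The vertex `d` is at distance 2 from `v`. -/
def InSecond (d : V) : Prop := d ≠ v ∧ ¬ G.Adj v d ∧ ∃ y, G.Adj v y ∧ G.Adj y d

/-- The neighbour `y` of `v` has a neighbour at distance 2 from `v`. -/
def HasPrivate (y : V) : Prop := G.Adj v y ∧ ∃ d, G.Adj y d ∧ d ≠ v ∧ ¬ G.Adj v d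

/-- The vertex `d` at distance 2 from `v` has a neighbour at distance 3 from `v`. -/
def HasThird (d : V) : Prop :=
  InSecond G v d ∧ ∃ c, G.Adj d c ∧ ¬ InSecond G v c ∧ ¬ G.Adj v c

/-- The neighbour `y` of `v` has a neighbour at distance 2 that has none at distance 3. -/
def IsBlocked (y : V) : Prop := G.Adj v y ∧ ∃ d, G.Adj y d ∧ InSecond G v d ∧ ¬ HasThird G v d

/-- The neighbours `y` and `x` of `v` form a triangle with `v`. -/
def IsMate (y x : V) : Prop := G.Adj v y ∧ G.Adj v x ∧ G.Adj y x

/-- The mate of the neighbour `y` of `v` has no neighbour at distance 2. -/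
def IsStuck (y : V) : Prop := ∃ x, IsMate G v y x ∧ ¬ HasPrivate G v x

/-- Except for non-emptiness, `Y` has all properties of the second side of a generating subgraph
with first side `{v}`. -/
structure IsAdmissible (Y : Finset V) : Prop where
  adj : ∀ y ∈ Y, G.Adj v y
  indep : ∀ y ∈ Y, ∀ x ∈ Y, ¬ G.Adj y x
  free : ∀ y ∈ Y, ¬ IsBlocked G v y
  dominates : ∀ y, G.Adj v y → y ∉ Y → (∃ x ∈ Y, G.Adj y x) ∨ HasPrivate G v y

variable {G v}

theorem IsMate.symm {y x : V} (h : IsMate G v y x) : IsMate G v x y := ⟨h.2.1, h.1, h.2.2.symm⟩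

/-- Two mates of `y` would close a 4-cycle through `v` and `y`. Hence components of the
neighbourhood of `v` have at most two vertices. -/
theorem ShortCycleFree.mate_unique (h : ShortCycleFree G) {y x x' : V} (hx : IsMate G v y x)
    (hx' : IsMate G v y x') : x = x' := by
  by_contra hne
  exact h.not_c4 hx.2.1 hx.2.2.symm hx'.2.2 hx'.2.1.symm hx.1.ne hne

theorem ShortCycleFree.parent_unique (h : ShortCycleFree G) {d y y' : V} (hd : d ≠ v)
    (hy : G.Adj v y) (hy' : G.Adj v y') (hyd : G.Adj y d) (hyd' : G.Adj y' d) : y = y' := by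
  by_contra hne
  exact h.not_c4 hy hyd hyd'.symm hy'.symm hd.symm hne

theorem ShortCycleFree.parent_eq_of_adj (h : ShortCycleFree G) {d e y z : V}
    (hd : d ≠ v) (hd' : ¬ G.Adj v d) (he : e ≠ v) (he' : ¬ G.Adj v e)
    (hy : G.Adj v y) (hz : G.Adj v z) (hyd : G.Adj y d) (hze : G.Adj z e) (hde : G.Adj d e) :
    y = z := by
  by_contra hne
  refine h.not_c5 hy hyd hde hze.symm hz.symm ?_
  have := hy.ne; have := hz.ne; have := hyd.ne; have := hze.ne; have := hde.ne
  have : y ≠ e := by rintro rfl; exact he' hy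
  have : d ≠ z := by rintro rfl; exact hd' hz
  simp_all [eq_comm]

/-- A child `d` of `y ∈ Y` is not in `S`, so `S` must dominate it for `S ∪ {v}` to be maximal. A
dominator at distance 2 would also be a child of `y`, contradicting independence of `S ∪ Y`; so it
lies at distance 3 and `y` is not blocked. -/
theorem isAdmissible_of_isGenerating (h : ShortCycleFree G) {Y : Finset V}
    (hY : IsGenerating G {v} Y) : IsAdmissible G v Y := by
  obtain ⟨⟨-, ⟨y₀, hy₀⟩, -, hYi, hvY⟩, S, hS, hSv, hSY⟩ := hY
  rw [isMaxIndep_iff] at hSv hSY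
  have hadj : ∀ y ∈ Y, G.Adj v y := fun y hy => hvY v (by simp) y hy
  have hSn : ∀ s ∈ S, ¬ G.Adj v s := fun s hs => hSv.1.not_adj (by simp) (by simp [hs])
  have hvS : v ∉ S := fun hv => hSY.1.not_adj (Or.inl hv) (Or.inr hy₀) (hadj _ hy₀)
  refine ⟨hadj, fun y hy x hx => hYi.not_adj hy hx, ?_, ?_⟩
  · rintro y hy ⟨hvy, d, hyd, hd, hd3⟩
    have hdS : d ∉ S := fun hdS => hSY.1.not_adj (Or.inr hy) (Or.inl hdS) hyd
    obtain ⟨s, hs, hds⟩ := hSv.2 d (by simp [hdS, hd.1])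
    have hsv : s ≠ v := by rintro rfl; exact hd.2.1 hds.symm
    have hsS : s ∈ S := by simpa [hsv] using hs
    have hs2 : InSecond G v s := by
      by_contra hs2
      exact hd3 ⟨hd, s, hds, hs2, hSn s hsS⟩
    obtain ⟨-, -, z, hz, hzs⟩ := hs2
    obtain rfl := h.parent_eq_of_adj hd.1 hd.2.1 hsv (hSn s hsS) hvy hz hyd hzs hds
    exact hSY.1.not_adj (Or.inr hy) (Or.inl hsS) hzs
  · intro y hy hyY
    have hyS : y ∉ S := fun hyS => hSn y hyS hy
    obtain ⟨s, hs | hs, hys⟩ := hSY.2 y (by simp [hyS, hyY])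
    · exact Or.inr ⟨hy, s, hys, fun hsv => hvS (hsv ▸ hs), hSn s hs⟩
    · exact Or.inl ⟨s, hs, hys⟩

/-- Extend `v` and suitable vertices at distances 2 and 3 to a maximal independent set `M`, and take
`S = M \ {v}`. -/
theorem IsAdmissible.isGenerating [Finite V] (h : ShortCycleFree G) {Y : Finset V}
    (hY : IsAdmissible G v Y) (hne : Y.Nonempty) : IsGenerating G {v} Y := by
  classical
  choose! c hc using fun d (hd : HasThird G v d) => hd.2
  choose! δ hδ using fun y (hy : HasPrivate G v y) => hy.2
  -- `C` contains a neighbour at distance 3 of every child of `Y` that has one, which keeps these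
  -- children out of `M`. `D` contains a child of every neighbour outside `Y` that has one, so that
  -- `S` dominates it.
  set C : Set V := {x | ∃ d y, y ∈ Y ∧ G.Adj y d ∧ HasThird G v d ∧ c d = x} with hC
  set D : Set V := {x | ∃ y, y ∉ Y ∧ HasPrivate G v y ∧ δ y = x} with hD
  have hvC : ∀ x ∈ C, ¬ G.Adj v x := by
    rintro x ⟨d, y, hy, hyd, hd, rfl⟩; exact (hc d hd).2.2
  have hvD : ∀ x ∈ D, ¬ G.Adj v x := by
    rintro x ⟨y, hy, hyd, rfl⟩; exact (hδ y hyd).2.2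
  have hCC : ∀ x ∈ C, ∀ x' ∈ C, ¬ G.Adj x x' := by
    rintro x ⟨d, y, hy, hyd, hd, rfl⟩ x' ⟨d', y', hy', hyd', hd', rfl⟩ hadj
    obtain ⟨hc1, hc2, hc3⟩ := hc d hd
    obtain ⟨hc1', hc2', hc3'⟩ := hc d' hd'
    have hdd : d ≠ d' := by rintro rfl; exact hadj.ne rfl
    have hvy := hY.adj y hy
    have hvy' := hY.adj y' hy'
    have e1 : c d ≠ v := by intro e; exact hd.1.2.1 (e ▸ hc1).symm
    have e1' : c d' ≠ v := by intro e; exact hd'.1.2.1 (e ▸ hc1').symm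
    have e2 : ∀ z, G.Adj v z → c d ≠ z := by rintro z hz rfl; exact hc3 hz
    have e2' : ∀ z, G.Adj v z → c d' ≠ z := by rintro z hz rfl; exact hc3' hz
    have e3 : ∀ z, InSecond G v z → c d ≠ z := by rintro z hz rfl; exact hc2 hz
    have e3' : ∀ z, InSecond G v z → c d' ≠ z := by rintro z hz rfl; exact hc2' hz
    have e4 : ∀ z, G.Adj v z → d ≠ z := by rintro z hz rfl; exact hd.1.2.1 hz
    have e4' : ∀ z, G.Adj v z → d' ≠ z := by rintro z hz rfl; exact hd'.1.2.1 hz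
    -- With a common parent the edge closes a 5-cycle avoiding `v`; otherwise it closes a 7-cycle
    -- through `v`.
    by_cases hyy : y = y'
    · subst hyy
      refine h.not_c5 hyd hc1 hadj hc1'.symm hyd'.symm ?_
      simp only [List.nodup_cons, List.mem_cons, List.not_mem_nil, or_false, not_or,
        not_false_eq_true, List.nodup_nil, and_true]
      exact ⟨⟨(e4 y hvy).symm, (e2 y hvy).symm, (e2' y hvy).symm, (e4' y hvy).symm⟩,
        ⟨(e3 d hd.1).symm, (e3' d hd.1).symm, hdd⟩, ⟨hadj.ne, e3 d' hd'.1⟩, e3' d' hd'.1⟩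
    · refine h.not_c7 hvy hyd hc1 hadj hc1'.symm hyd'.symm hvy'.symm ?_
      simp only [List.nodup_cons, List.mem_cons, List.not_mem_nil, or_false, not_or,
        not_false_eq_true, List.nodup_nil, and_true]
      exact ⟨⟨hvy.ne, hd.1.1.symm, e1.symm, e1'.symm, hd'.1.1.symm, hvy'.ne⟩,
        ⟨(e4 y hvy).symm, (e2 y hvy).symm, (e2' y hvy).symm, (e4' y hvy).symm, hyy⟩,
        ⟨(e3 d hd.1).symm, (e3' d hd.1).symm, hdd, e4 y' hvy'⟩,
        ⟨hadj.ne, e3 d' hd'.1, e2 y' hvy'⟩, ⟨e3' d' hd'.1, e2' y' hvy'⟩, e4' y' hvy'⟩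
  have hCD : ∀ x ∈ C, ∀ x' ∈ D, ¬ G.Adj x x' := by
    rintro x ⟨d, y, hy, hyd, hd, rfl⟩ x' ⟨y', hy', hp, rfl⟩ hadj
    obtain ⟨hc1, hc2, hc3⟩ := hc d hd
    obtain ⟨hd1, hd2, hd3⟩ := hδ y' hp
    have hvy := hY.adj y hy
    have hvy' := hp.1
    have hyy : y ≠ y' := by rintro rfl; exact hy' hy
    have hdd : d ≠ δ y' := by
      intro e
      exact hyy (h.parent_unique hd.1.1 hvy hvy' hyd (e ▸ hd1))
    have e1 : c d ≠ v := by intro e; exact hd.1.2.1 (e ▸ hc1).symm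
    have e2 : ∀ z, G.Adj v z → c d ≠ z := by rintro z hz rfl; exact hc3 hz
    have e3 : c d ≠ d := hc1.ne'
    have e4 : ∀ z, G.Adj v z → d ≠ z := by rintro z hz rfl; exact hd.1.2.1 hz
    have e5 : ∀ z, G.Adj v z → δ y' ≠ z := by rintro z hz rfl; exact hd3 hz
    -- The parents differ because one lies in `Y` and the other does not; so the 6-cycle through `v`
    -- is genuine.
    refine h.not_c6 hvy hyd hc1 hadj hd1.symm hvy'.symm ?_
    simp only [List.nodup_cons, List.mem_cons, List.not_mem_nil, or_false, not_or,
      not_false_eq_true, List.nodup_nil, and_true]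
    exact ⟨⟨hvy.ne, hd.1.1.symm, e1.symm, hd2.symm, hvy'.ne⟩,
      ⟨(e4 y hvy).symm, (e2 y hvy).symm, (e5 y hvy).symm, hyy⟩,
      ⟨e3.symm, hdd, e4 y' hvy'⟩, ⟨hadj.ne, e2 y' hvy'⟩, e5 y' hvy'⟩
  have hDD : ∀ x ∈ D, ∀ x' ∈ D, ¬ G.Adj x x' := by
    rintro x ⟨y, hy, hp, rfl⟩ x' ⟨y', hy', hp', rfl⟩ hadj
    obtain ⟨hd1, hd2, hd3⟩ := hδ y hp
    obtain ⟨hd1', hd2', hd3'⟩ := hδ y' hp'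
    obtain rfl := h.parent_eq_of_adj hd2 hd3 hd2' hd3' hp.1 hp'.1 hd1 hd1' hadj
    exact hadj.ne rfl
  have hind : G.IsIndepSet (insert v (C ∪ D)) := by
    rintro a (rfl | ha | ha) b (rfl | hb | hb) hab
    · exact absurd rfl hab
    · exact hvC b hb
    · exact hvD b hb
    · exact fun h' => hvC a ha h'.symm
    · exact hCC a ha b hb
    · exact hCD a ha b hb
    · exact fun h' => hvD a ha h'.symm
    · exact fun h' => hCD b hb a ha h'.symm
    · exact hDD a ha b hb
  obtain ⟨M, hM, hMax⟩ := exists_isMaxIndep_superset hind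
  have hvM : v ∈ M := hM (Set.mem_insert _ _)
  have hCM : ∀ x ∈ C, x ∈ M := fun x hx => hM (Or.inr (Or.inl hx))
  have hDM : ∀ x ∈ D, x ∈ M := fun x hx => hM (Or.inr (Or.inr hx))
  have hMax' := isMaxIndep_iff.1 hMax
  have hMv : ∀ s ∈ M, ¬ G.Adj v s := fun s hs => hMax'.1.not_adj hvM hs
  -- Such an `s` would be a child of `y`. As `y` is not blocked, `s` has its chosen neighbour in `C
  -- ⊆ M`.
  have hMY : ∀ s ∈ M, s ≠ v → ∀ y ∈ Y, ¬ G.Adj y s := by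
    intro s hs hsv y hy hys
    have hs2 : InSecond G v s := ⟨hsv, hMv s hs, y, hY.adj y hy, hys⟩
    have hs3 : HasThird G v s := by
      by_contra hs3
      exact hY.free y hy ⟨hY.adj y hy, s, hys, hs2, hs3⟩
    exact hMax'.1.not_adj hs (hCM _ ⟨s, y, hy, hys, hs3, rfl⟩) (hc s hs3).1
  refine ⟨⟨by simp, hne, by simp, fun a ha b hb _ => hY.indep a ha b hb, ?_⟩,
    M \ {v}, ?_, ?_, ?_⟩
  · simpa using hY.adj
  · exact fun a ha b hb => hMax'.1 ha.1 hb.1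
  · have : M \ {v} ∪ (({v} : Finset V) : Set V) = M := by simpa using hvM
    rwa [this]
  · rw [isMaxIndep_iff]
    constructor
    · rintro a (ha | ha) b (hb | hb) hab
      · exact hMax'.1 ha.1 hb.1 hab
      · exact fun h' => hMY a ha.1 ha.2 b hb h'.symm
      · exact hMY b hb.1 hb.2 a ha
      · exact hY.indep a ha b hb
    · intro x hx
      by_cases hxv : x = v
      · obtain ⟨y, hy⟩ := hne
        exact ⟨y, Or.inr hy, hxv ▸ hY.adj y hy⟩
      by_cases hvx : G.Adj v x
      · rcases hY.dominates x hvx (fun hxY => hx (Or.inr hxY)) with ⟨y, hy, hxy⟩ | hp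
        · exact ⟨y, Or.inr hy, hxy⟩
        · exact ⟨δ x, Or.inl ⟨hDM _ ⟨x, fun hxY => hx (Or.inr hxY), hp, rfl⟩, (hδ x hp).2.1⟩,
            (hδ x hp).1⟩
      · obtain ⟨s, hs, hxs⟩ := hMax'.2 x (fun hxM => hx (Or.inl ⟨hxM, hxv⟩))
        refine ⟨s, Or.inl ⟨hs, ?_⟩, hxs⟩
        rintro rfl
        exact hvx hxs.symm

/-! ### Changing an admissible set within one component of the neighbourhood -/

variable [DecidableEq V]

/-- Only `u` and its mate can lose a dominator, and both have children. -/
theorem IsAdmissible.erase_of_not_isStuck {Y : Finset V} (hY : IsAdmissible G v Y) {u : V}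
    (hu : HasPrivate G v u) (hs : ¬ IsStuck G v u) : IsAdmissible G v (Y.erase u) := by
  refine ⟨fun y hy => hY.adj y (Finset.mem_of_mem_erase hy),
    fun y hy x hx => hY.indep y (Finset.mem_of_mem_erase hy) x (Finset.mem_of_mem_erase hx),
    fun y hy => hY.free y (Finset.mem_of_mem_erase hy), fun y hy hyY => ?_⟩
  by_cases hyu : y = u
  · exact Or.inr (hyu ▸ hu)
  by_cases hyu' : G.Adj y u
  · refine Or.inr ?_
    by_contra hp
    exact hs ⟨y, ⟨hu.1, hy, hyu'.symm⟩, hp⟩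
  · rcases hY.dominates y hy (fun h' => hyY (Finset.mem_erase.2 ⟨hyu, h'⟩)) with ⟨x, hx, hyx⟩ | hp
    · exact Or.inl ⟨x, Finset.mem_erase.2 ⟨fun e => hyu' (e ▸ hyx), hx⟩, hyx⟩
    · exact Or.inr hp

theorem IsAdmissible.insert_of_not_adj {Y : Finset V} (hY : IsAdmissible G v Y) {u : V}
    (hu : G.Adj v u) (hf : ¬ IsBlocked G v u) (hi : ∀ y ∈ Y, ¬ G.Adj u y) :
    IsAdmissible G v (insert u Y) := by
  refine ⟨?_, ?_, ?_, ?_⟩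
  · simpa [hu] using hY.adj
  · intro y hy x hx
    rcases Finset.mem_insert.1 hy with rfl | hy' <;> rcases Finset.mem_insert.1 hx with rfl | hx'
    · exact G.loopless.irrefl _
    · exact hi x hx'
    · exact fun h' => hi y hy' h'.symm
    · exact hY.indep y hy' x hx'
  · simpa [hf] using hY.free
  · intro y hy hyY
    rcases hY.dominates y hy (fun h' => hyY (Finset.mem_insert_of_mem h')) with ⟨x, hx, hyx⟩ | hp
    · exact Or.inl ⟨x, Finset.mem_insert_of_mem hx, hyx⟩
    · exact Or.inr hp

/-- The change stays within the component `{u, x}`, where `u` dominates `x` as `x` dominated `u`. -/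
theorem IsAdmissible.swap (h : ShortCycleFree G) {Y : Finset V} (hY : IsAdmissible G v Y)
    {u x : V} (hx : x ∈ Y) (hux : IsMate G v u x) (hf : ¬ IsBlocked G v u) :
    IsAdmissible G v (insert u (Y.erase x)) := by
  refine ⟨?_, ?_, ?_, ?_⟩
  · intro y hy
    rcases Finset.mem_insert.1 hy with rfl | hy
    · exact hux.1
    · exact hY.adj y (Finset.mem_of_mem_erase hy)
  · have key : ∀ y ∈ Y.erase x, ¬ G.Adj u y := fun y hy huy =>
      (Finset.mem_erase.1 hy).1
        (h.mate_unique ⟨hux.1, hY.adj y (Finset.mem_of_mem_erase hy), huy⟩ hux)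
    intro y hy z hz
    rcases Finset.mem_insert.1 hy with rfl | hy' <;> rcases Finset.mem_insert.1 hz with rfl | hz'
    · exact G.loopless.irrefl _
    · exact key z hz'
    · exact fun h' => key y hy' h'.symm
    · exact hY.indep y (Finset.mem_of_mem_erase hy') z (Finset.mem_of_mem_erase hz')
  · intro y hy
    rcases Finset.mem_insert.1 hy with rfl | hy
    · exact hf
    · exact hY.free y (Finset.mem_of_mem_erase hy)
  · intro y hy hyY
    by_cases hyx : y = x
    · exact Or.inl ⟨u, Finset.mem_insert_self _ _, hyx ▸ hux.2.2.symm⟩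
    · rw [Finset.mem_insert, Finset.mem_erase, not_or, not_and] at hyY
      rcases hY.dominates y hy (hyY.2 hyx) with ⟨z, hz, hyz⟩ | hp
      · refine Or.inl ⟨z, Finset.mem_insert_of_mem (Finset.mem_erase.2 ⟨?_, hz⟩), hyz⟩
        rintro rfl
        exact hyY.1 (h.mate_unique (y := z) ⟨hux.2.1, hy, hyz.symm⟩ hux.symm)
      · exact Or.inr hp

end Layers

/-! ### The family -/

section Family

variable {V : Type*} [LinearOrder V] (G : SimpleGraph V) (v : V)

/-- The neighbour `y` of `v` has a smaller mate that is not blocked. -/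
def IsBeaten (y : V) : Prop := ∃ x, IsMate G v y x ∧ ¬ IsBlocked G v x ∧ x < y

/-- `y` belongs to the base set: it is the smallest vertex that is not blocked in a component
of the neighbourhood of `v`. -/
def InBase (y : V) : Prop := G.Adj v y ∧ ¬ IsBlocked G v y ∧ ¬ IsBeaten G v y

/-- `z` belongs to the set that `u` contributes to the family. -/
def InMember (u z : V) : Prop :=
  (u = v ∧ InBase G v z) ∨
  (InBase G v u ∧ HasPrivate G v u ∧ ¬ IsStuck G v u ∧ InBase G v z ∧ z ≠ u) ∨
  (G.Adj v u ∧ ¬ IsBlocked G v u ∧ IsBeaten G v u ∧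
    (z = u ∨ (InBase G v z ∧ ¬ IsMate G v u z)))

open Classical in
/-- The set that `u` contributes to the family. -/
noncomputable def memberSet [Fintype V] (u : V) : Finset V :=
  Finset.univ.filter (InMember G v u)

open Classical in
/-- The base set. -/
noncomputable def baseSet [Fintype V] : Finset V :=
  Finset.univ.filter (InBase G v)

variable {G v}

/-- The smaller unblocked mate cannot itself be beaten, since its only mate is the larger vertex
`u`. -/
theorem exists_mate_inBase (h : ShortCycleFree G) {u : V} (hb : ¬ IsBlocked G v u)
    (hu : IsBeaten G v u) : ∃ x, IsMate G v u x ∧ InBase G v x := by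
  obtain ⟨x, hx, hxb, hlt⟩ := hu
  refine ⟨x, hx, hx.2.1, hxb, ?_⟩
  rintro ⟨z, hz, -, hlt'⟩
  obtain rfl := h.mate_unique hz hx.symm
  exact lt_asymm hlt hlt'

theorem constraintForm_insert {Y : Finset V} {u : V} (hu : u ∉ Y) :
    constraintForm ({v}, insert u Y) = constraintForm ({v}, Y) - LinearMap.proj u := by
  simp only [constraintForm, Finset.sum_insert hu]
  abel

theorem constraintForm_erase {Y : Finset V} {u : V} (hu : u ∈ Y) :
    constraintForm ({v}, Y.erase u) = constraintForm ({v}, Y) + LinearMap.proj u := by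
  conv_rhs => rw [← Finset.insert_erase hu]
  rw [constraintForm_insert (Finset.notMem_erase u Y)]
  abel

variable [Fintype V]

@[simp] theorem mem_baseSet {z : V} : z ∈ baseSet G v ↔ InBase G v z := by
  simp [baseSet]

@[simp] theorem mem_memberSet {u z : V} : z ∈ memberSet G v u ↔ InMember G v u z := by
  simp [memberSet]

theorem memberSet_self : memberSet G v v = baseSet G v := by
  ext z
  simp [InMember, InBase]

theorem memberSet_of_inBase {u : V} (hu : InBase G v u) (hp : HasPrivate G v u)
    (hs : ¬ IsStuck G v u) : memberSet G v u = (baseSet G v).erase u := by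
  ext z
  have h1 : u ≠ v := hu.1.ne'
  have h2 : ¬ IsBeaten G v u := hu.2.2
  simp [InMember, h1, h2, hu, hp, hs, and_comm]

theorem memberSet_of_isBeaten (h : ShortCycleFree G) {u x : V} (hb : ¬ IsBlocked G v u)
    (hu : IsBeaten G v u) (hx : IsMate G v u x) :
    memberSet G v u = insert u ((baseSet G v).erase x) := by
  ext z
  have h1 : u ≠ v := hx.1.ne'
  have h2 : ¬ InBase G v u := fun h' => h'.2.2 hu
  have h3 : IsMate G v u z ↔ z = x :=
    ⟨fun h' => h.mate_unique h' hx, fun h' => h' ▸ hx⟩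
  simp [InMember, h1, h2, h3, hx.1, hb, hu, and_comm]

/-- A neighbour outside the base set is either blocked, and then has a child, or beaten, and then
has its mate in the base set. -/
theorem isAdmissible_baseSet (h : ShortCycleFree G) : IsAdmissible G v (baseSet G v) := by
  refine ⟨fun y hy => (mem_baseSet.1 hy).1, ?_, fun y hy => (mem_baseSet.1 hy).2.1, ?_⟩
  · intro y hy x hx hyx
    rw [mem_baseSet] at hy hx
    rcases lt_or_gt_of_ne hyx.ne with hlt | hlt
    · exact hx.2.2 ⟨y, ⟨hx.1, hy.1, hyx.symm⟩, hy.2.1, hlt⟩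
    · exact hy.2.2 ⟨x, ⟨hy.1, hx.1, hyx⟩, hx.2.1, hlt⟩
  · simp only [mem_baseSet]
    intro y hy hyb
    by_cases hbl : IsBlocked G v y
    · obtain ⟨-, d, hyd, hd, -⟩ := hbl
      exact Or.inr ⟨hy, d, hyd, hd.1, hd.2.1⟩
    · have hbt : IsBeaten G v y := by
        by_contra hbt
        exact hyb ⟨hy, hbl, hbt⟩
      obtain ⟨x, hx, hxb⟩ := exists_mate_inBase h hbl hbt
      exact Or.inl ⟨x, hxb, hx.2.2⟩

theorem isAdmissible_memberSet (h : ShortCycleFree G) {u : V} (hne : (memberSet G v u).Nonempty) :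
    IsAdmissible G v (memberSet G v u) := by
  obtain ⟨z, hz⟩ := hne
  rw [mem_memberSet] at hz
  rcases hz with ⟨rfl, -⟩ | ⟨hu, hp, hs, -⟩ | ⟨-, hb, hu, -⟩
  · rw [memberSet_self]
    exact isAdmissible_baseSet h
  · rw [memberSet_of_inBase hu hp hs]
    exact (isAdmissible_baseSet h).erase_of_not_isStuck hp hs
  · obtain ⟨x, hx, hxb⟩ := exists_mate_inBase h hb hu
    rw [memberSet_of_isBeaten h hb hu hx]
    exact (isAdmissible_baseSet h).swap h (mem_baseSet.2 hxb) hx hb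

variable (G v) in
/-- The non-empty sets that vertices contribute. -/
def memberFamily : Set (Finset V) := {Y | Y.Nonempty ∧ ∃ u, Y = memberSet G v u}

/-- Induction on the size of the symmetric difference of `Y` and the base set. Each step moves one
component of `Y` back to its base choice, and the form changes by the difference of the base form
and one member's form. Vertices outside the base set are treated first, so that the remaining case
has `Y` contained in the base set. -/
theorem constraintForm_mem_span (h : ShortCycleFree G) {Y : Finset V} (hY : IsAdmissible G v Y)
    (hne : Y.Nonempty) :
    constraintForm ({v}, Y) ∈
      Submodule.span ℝ ((fun Z => constraintForm ({v}, Z)) '' memberFamily G v) := by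
  have mem : ∀ u, (memberSet G v u).Nonempty → constraintForm ({v}, memberSet G v u) ∈
      Submodule.span ℝ ((fun Z => constraintForm ({v}, Z)) '' memberFamily G v) := fun u hu =>
    Submodule.subset_span ⟨_, ⟨hu, u, rfl⟩, rfl⟩
  induction hk : (Y \ baseSet G v).card + (baseSet G v \ Y).card using Nat.strong_induction_on
    generalizing Y with
  | _ k ih =>
    subst hk
    by_cases h1 : (Y \ baseSet G v).Nonempty
    · obtain ⟨u, hu⟩ := h1
      obtain ⟨huY, huB⟩ := Finset.mem_sdiff.1 hu
      rw [mem_baseSet] at huB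
      have hbl := hY.free u huY
      have hbt : IsBeaten G v u := by
        by_contra hbt
        exact huB ⟨hY.adj u huY, hbl, hbt⟩
      obtain ⟨x, hx, hxb⟩ := exists_mate_inBase h hbl hbt
      have hxB : x ∈ baseSet G v := mem_baseSet.2 hxb
      have hxY : x ∉ Y := fun hxY => hY.indep u huY x hxY hx.2.2
      have hux : u ≠ x := hx.2.2.ne
      have hxY' : x ∉ Y.erase u := fun h' => hxY (Finset.mem_of_mem_erase h')
      have huB' : u ∉ (baseSet G v).erase x := fun h' =>
        huB (mem_baseSet.1 (Finset.mem_of_mem_erase h'))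
      have hrec := ih _ ?_ (hY.swap h huY hx.symm hxb.2.1) (Finset.insert_nonempty _ _) rfl
      · have e1 := mem u (by
          rw [memberSet_of_isBeaten h hbl hbt hx]; exact Finset.insert_nonempty _ _)
        have e2 := mem v (by rw [memberSet_self]; exact ⟨x, hxB⟩)
        rw [memberSet_of_isBeaten h hbl hbt hx, constraintForm_insert huB',
          constraintForm_erase hxB] at e1
        rw [memberSet_self] at e2
        rw [constraintForm_insert hxY', constraintForm_erase huY] at hrec
        convert Submodule.add_mem _ hrec (Submodule.sub_mem _ e1 e2) using 1
        abel
      · refine add_lt_add_of_lt_of_le (Finset.card_lt_card ?_) (Finset.card_le_card ?_)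
        · refine Finset.ssubset_iff_subset_ne.2 ⟨?_, fun e => ?_⟩
          · intro a ha
            simp only [Finset.mem_sdiff, Finset.mem_insert, Finset.mem_erase] at ha ⊢
            rcases ha with ⟨rfl | ha, hb⟩
            · exact absurd hxB hb
            · exact ⟨ha.2, hb⟩
          · rw [← e] at hu
            simp [hux] at hu
        · intro a ha
          simp only [Finset.mem_sdiff, Finset.mem_insert, Finset.mem_erase, not_or, not_and] at ha ⊢
          refine ⟨ha.1, ha.2.2 ?_⟩
          rintro rfl
          exact huB (mem_baseSet.1 ha.1)
    rw [Finset.not_nonempty_iff_eq_empty, Finset.sdiff_eq_empty_iff_subset] at h1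
    by_cases h2 : (baseSet G v \ Y).Nonempty
    · obtain ⟨u, hu⟩ := h2
      obtain ⟨huB, huY⟩ := Finset.mem_sdiff.1 hu
      have hub := mem_baseSet.1 huB
      have hB := isAdmissible_baseSet (v := v) h
      have hi : ∀ y ∈ Y, ¬ G.Adj u y := fun y hy => hB.indep u huB y (h1 hy)
      have hp : HasPrivate G v u := by
        rcases hY.dominates u hub.1 huY with ⟨y, hy, huy⟩ | hp
        · exact absurd huy (hi y hy)
        · exact hp
      -- The mate of `u` is outside `Y` and its only possible dominator in `Y` would be `u`; so it
      -- must have a child.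
      have hs : ¬ IsStuck G v u := by
        rintro ⟨x, hx, hxp⟩
        have hxY : x ∉ Y := fun hxY => hi x hxY hx.2.2
        rcases hY.dominates x hx.2.1 hxY with ⟨y, hy, hxy⟩ | hp
        · exact huY (h.mate_unique hx.symm ⟨hx.2.1, hY.adj y hy, hxy⟩ ▸ hy)
        · exact hxp hp
      have hYsub : Y ⊆ (baseSet G v).erase u := fun y hy =>
        Finset.mem_erase.2 ⟨fun e => huY (e ▸ hy), h1 hy⟩
      have hrec := ih _ ?_ (hY.insert_of_not_adj hub.1 hub.2.1 hi) (Finset.insert_nonempty _ _) rfl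
      -- The erased base set contains the non-empty `Y`. This is why discarding empty members from
      -- the family does no harm.
      · have e1 := mem u (by rw [memberSet_of_inBase hub hp hs]; exact hne.mono hYsub)
        have e2 := mem v (by rw [memberSet_self]; exact ⟨u, huB⟩)
        rw [memberSet_of_inBase hub hp hs, constraintForm_erase huB] at e1
        rw [memberSet_self] at e2
        rw [constraintForm_insert huY] at hrec
        convert Submodule.add_mem _ hrec (Submodule.sub_mem _ e1 e2) using 1
        abel
      · refine add_lt_add_of_le_of_lt (Finset.card_le_card ?_) (Finset.card_lt_card ?_)
        · intro a ha
          simp only [Finset.mem_sdiff, Finset.mem_insert] at ha ⊢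
          rcases ha with ⟨rfl | ha, hb⟩
          · exact absurd huB hb
          · exact ⟨ha, hb⟩
        · refine Finset.ssubset_iff_subset_ne.2 ⟨?_, fun e => ?_⟩
          · exact Finset.sdiff_subset_sdiff le_rfl (Finset.subset_insert _ _)
          · rw [← e] at hu
            simp at hu
    rw [Finset.not_nonempty_iff_eq_empty, Finset.sdiff_eq_empty_iff_subset] at h2
    obtain rfl : Y = baseSet G v := h1.antisymm h2
    have := mem v (by rwa [memberSet_self])
    rwa [memberSet_self] at this

theorem isGenerating_of_mem_memberFamily (h : ShortCycleFree G) {Y : Finset V}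
    (hY : Y ∈ memberFamily G v) : IsGenerating G {v} Y := by
  obtain ⟨hne, u, rfl⟩ := hY
  exact (isAdmissible_memberSet h hne).isGenerating h hne

theorem span_memberFamily (h : ShortCycleFree G) :
    Submodule.span ℝ (constraintForm '' {B | ∃ Y ∈ memberFamily G v, B = ({v}, Y)}) =
      Submodule.span ℝ (constraintForm '' generatingAt G v) := by
  apply le_antisymm
  · refine Submodule.span_mono (Set.image_mono ?_)
    rintro _ ⟨Y, hY, rfl⟩
    exact ⟨rfl, isGenerating_of_mem_memberFamily h hY⟩
  · rw [Submodule.span_le]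
    rintro _ ⟨⟨X, Y⟩, ⟨hX, hY⟩, rfl⟩
    obtain rfl : X = {v} := hX
    refine Submodule.span_mono ?_
      (constraintForm_mem_span h (isAdmissible_of_isGenerating h hY) hY.1.2.1)
    rintro _ ⟨Z, hZ, rfl⟩
    exact ⟨_, ⟨Z, hZ, rfl⟩, rfl⟩

end Family

/-! ### Solution spaces as common zeros of spans of forms -/

theorem mem_solutionSpace_iff {V : Type*} {𝓕 : Set (Finset V × Finset V)} {w : V → ℝ} :
    w ∈ solutionSpace 𝓕 ↔ ∀ f ∈ Submodule.span ℝ (constraintForm '' 𝓕), f w = 0 := by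
  have key : ∀ B : Finset V × Finset V,
      constraintForm B w = ∑ x ∈ B.1, w x - ∑ y ∈ B.2, w y := fun B => by
    simp [constraintForm, LinearMap.sum_apply]
  constructor
  · intro hw f hf
    induction hf using Submodule.span_induction with
    | mem f hf =>
      obtain ⟨B, hB, rfl⟩ := hf
      rw [key, sub_eq_zero]
      exact hw B hB
    | zero => simp
    | add f g _ _ hf hg => simp [hf, hg]
    | smul a f _ hf => simp [hf]
  · intro hw B hB
    rw [← sub_eq_zero, ← key]
    exact hw _ (Submodule.subset_span ⟨B, hB, rfl⟩)

theorem solutionSpace_eq_of_span_eq {V : Type*} {𝓕 𝓖 : Set (Finset V × Finset V)}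
    (h : Submodule.span ℝ (constraintForm '' 𝓕) = Submodule.span ℝ (constraintForm '' 𝓖)) :
    solutionSpace 𝓕 = solutionSpace 𝓖 := by
  ext w
  rw [mem_solutionSpace_iff, mem_solutionSpace_iff, h]

/-! ### Running programs -/

section Runs

/-- Started with memory `s`, the program `p` halts after at most `T` steps, with a memory that
satisfies `Q`. -/
def Runs (s : RamState) (p : RamProg) (T : ℕ) (Q : RamState → Prop) : Prop :=
  ∃ t s', RamExec p s t s' ∧ t ≤ T ∧ Q s'

@[simp] theorem RamState.var_setVar (s : RamState) (x k y : ℕ) :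
    (s.setVar x k).var y = if y = x then k else s.var y := by
  simp [RamState.setVar, Function.update_apply]

@[simp] theorem RamState.arr_setVar (s : RamState) (x k : ℕ) : (s.setVar x k).arr = s.arr := rfl

@[simp] theorem RamState.var_setArr (s : RamState) (a i k : ℕ) : (s.setArr a i k).var = s.var := rfl

theorem RamState.arr_setArr (s : RamState) (a i k b : ℕ) :
    (s.setArr a i k).arr b = if b = a then Function.update (s.arr a) i k else s.arr b := by
  by_cases h : b = a
  · subst h; simp [RamState.setArr]
  · simp [RamState.setArr, h]

@[simp] theorem RamState.arr_setArr_self (s : RamState) (a i k : ℕ) :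
    (s.setArr a i k).arr a = Function.update (s.arr a) i k := by
  simp [RamState.arr_setArr]

theorem RamState.arr_setArr_of_ne (s : RamState) (a i k : ℕ) {b : ℕ} (h : b ≠ a) :
    (s.setArr a i k).arr b = s.arr b := by
  simp [RamState.arr_setArr, h]

namespace Runs

variable {s : RamState} {p q : RamProg} {T T' : ℕ} {Q R : RamState → Prop}

theorem mono (h : Runs s p T Q) (hT : T ≤ T') (hQ : ∀ s', Q s' → R s') : Runs s p T' R := by
  obtain ⟨t, s', h1, h2, h3⟩ := h
  exact ⟨t, s', h1, h2.trans hT, hQ s' h3⟩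

theorem skip (h : Q s) : Runs s .skip 1 Q := ⟨1, s, .skip s, le_rfl, h⟩

theorem assign {x : ℕ} {e : RamExp} (h : Q (s.setVar x (e.eval s))) :
    Runs s (.assign x e) (e.cost + 1) Q := ⟨_, _, .assign s x e, le_rfl, h⟩

theorem store {a : ℕ} {i e : RamExp} (h : Q (s.setArr a (i.eval s) (e.eval s))) :
    Runs s (.store a i e) (i.cost + e.cost + 1) Q := ⟨_, _, .store s a i e, le_rfl, h⟩

theorem seq (hp : Runs s p T R) (hq : ∀ s', R s' → Runs s' q T' Q) :
    Runs s (.seq p q) (T + T') Q := by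
  obtain ⟨t, s', h1, h2, h3⟩ := hp
  obtain ⟨t', s'', h1', h2', h3'⟩ := hq s' h3
  exact ⟨_, _, .seq h1 h1', add_le_add h2 h2', h3'⟩

theorem cond {b : RamTest} (hp : b.holds s → Runs s p T Q) (hq : ¬ b.holds s → Runs s q T Q) :
    Runs s (.cond b p q) (b.cost + 1 + T) Q := by
  by_cases hb : b.holds s
  · obtain ⟨t, s', h1, h2, h3⟩ := hp hb
    exact ⟨_, _, .cond_true hb h1, by omega, h3⟩
  · obtain ⟨t, s', h1, h2, h3⟩ := hq hb
    exact ⟨_, _, .cond_false hb h1, by omega, h3⟩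

end Runs

/-- The program that runs `p` for all values of the register `x` below that of the register `r`. -/
def forBelow (x r : ℕ) (p : RamProg) : RamProg :=
  .seq (.assign x (.const 0))
    (.loop (.lt (.var x) (.var r)) (.seq p (.assign x (.succ (.var x)))))

/-- Each round costs 4 for the test and 3 for the increment besides the body. The final 6 is the
initial assignment and the failing test. The invariant is stated with the counter already advanced.
-/
theorem Runs.forBelow {s : RamState} {x r N T : ℕ} {p : RamProg} (I : ℕ → RamState → Prop)
    (hrx : r ≠ x) (hr : s.var r = N) (h0 : I 0 (s.setVar x 0))
    (hstep : ∀ k s', k < N → s'.var x = k → s'.var r = N → I k s' →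
      Runs s' p T fun s'' => s''.var x = k ∧ s''.var r = N ∧ I (k + 1) (s''.setVar x (k + 1))) :
    Runs s (forBelow x r p) (N * (T + 7) + 6) (I N) := by
  have key : ∀ d k s', k + d = N → s'.var x = k → s'.var r = N → I k s' →
      Runs s' (.loop (.lt (.var x) (.var r)) (.seq p (.assign x (.succ (.var x)))))
        (d * (T + 7) + 4) (I N) := by
    intro d
    induction d with
    | zero =>
      intro k s' hk hx hr hI
      refine ⟨_, s', RamExec.loop_stop ?_, by simp [RamTest.cost, RamExp.cost], ?_⟩
      · simp [RamTest.holds, RamExp.eval, hx, hr]; omega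
      · obtain rfl : k = N := by omega
        exact hI
    | succ d ih =>
      intro k s' hk hx hr hI
      obtain ⟨t, s'', h1, h2, h3, h4, h5⟩ := hstep k s' (by omega) hx hr hI
      obtain ⟨t', s₃, h1', h2', h3'⟩ := ih (k + 1) (s''.setVar x (k + 1)) (by omega) (by simp)
        (by simp [hrx, h4]) h5
      refine ⟨_, s₃, .loop_step (t' := t') ?_ (.seq h1 (.assign _ _ _)) ?_, ?_, h3'⟩
      · simp [RamTest.holds, RamExp.eval, hx, hr]; omega
      · simpa [RamExp.eval, h3] using h1'
      · simp only [RamTest.cost, RamExp.cost]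
        have : (d + 1) * (T + 7) = d * (T + 7) + (T + 7) := by ring
        omega
  refine (Runs.seq (T := 2) (R := fun s' => s' = s.setVar x 0)
    (Runs.assign (e := .const 0) rfl) ?_).mono
    (T := 2 + (N * (T + 7) + 4)) (by omega) fun _ h => h
  rintro _ rfl
  exact key N 0 _ (by omega) (by simp) (by simp [hrx, hr]) h0

end Runs

/-! ### Graphs in memory -/

section Passes

variable {n : ℕ}

/-- The memory holds `G` and `v`, the arrays 0 and 1 listing both orientations of every edge. -/
structure HoldsGraph (G : SimpleGraph (Fin n)) (v : Fin n) (M : ℕ) (s : RamState) : Prop where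
  var_zero : s.var 0 = n
  var_two : s.var 2 = v
  var_four : s.var 4 = M
  adj_of_lt : ∀ j < M, ∃ a b : Fin n, G.Adj a b ∧ s.arr 0 j = a ∧ s.arr 1 j = b
  exists_of_adj : ∀ a b : Fin n, G.Adj a b → ∃ j < M, s.arr 0 j = a ∧ s.arr 1 j = b

/-- The array `A` of `s` marks the vertices with the property `p` by the entry 1. -/
def Marks (s : RamState) (A : ℕ) (p : Fin n → Prop) : Prop := ∀ u : Fin n, s.arr A u = 1 ↔ p u

/-- `s` and `s'` differ at most in the register 3 and the array `A`. -/
structure AgreeOff (A : ℕ) (s s' : RamState) : Prop where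
  var : ∀ x, x ≠ 3 → s'.var x = s.var x
  arr : ∀ B, B ≠ A → s'.arr B = s.arr B

theorem AgreeOff.marks {A B : ℕ} {s s' : RamState} {p : Fin n → Prop} (h : AgreeOff A s s')
    (hp : Marks s B p) (hB : B ≠ A) : Marks s' B p := by
  intro u
  rw [h.arr B hB]
  exact hp u

theorem AgreeOff.holdsGraph {A M : ℕ} {s s' : RamState} {G : SimpleGraph (Fin n)} {v : Fin n}
    (h : AgreeOff A s s') (hs : HoldsGraph G v M s) (hA : 2 ≤ A) : HoldsGraph G v M s' := by
  have h0 := h.arr 0 (by omega)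
  have h1 := h.arr 1 (by omega)
  refine ⟨?_, ?_, ?_, ?_, ?_⟩
  · rw [h.var 0 (by omega), hs.var_zero]
  · rw [h.var 2 (by omega), hs.var_two]
  · rw [h.var 4 (by omega), hs.var_four]
  · rw [h0, h1]; exact hs.adj_of_lt
  · rw [h0, h1]; exact hs.exists_of_adj

/-- All arrays from the array `A` on are zero. -/
def ZeroFrom (A : ℕ) (s : RamState) : Prop := ∀ B, A ≤ B → ∀ i, s.arr B i = 0

theorem AgreeOff.zeroFrom {A : ℕ} {s s' : RamState} (h : AgreeOff A s s') (hs : ZeroFrom A s) :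
    ZeroFrom (A + 1) s' := by
  intro B hB i
  rw [h.arr B (by omega)]
  exact hs B (by omega) i

/-- For every oriented edge that passes the test, store the value in the array `A` at the first
end. -/
def edgePass (A : ℕ) (b : RamTest) (e : RamExp) : RamProg :=
  forBelow 3 4 (.cond b (.store A (.arr 0 (.var 3)) e) .skip)

/-- Later edges may overwrite earlier entries, so the result only guarantees the value of some
admissible edge at `x`. -/
theorem runs_edgePass {G : SimpleGraph (Fin n)} {v : Fin n} {M A : ℕ} {s : RamState} {b : RamTest}
    {e : RamExp} (hs : HoldsGraph G v M s) (hA : 2 ≤ A) (p : Fin n → Fin n → Prop)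
    (f : Fin n → Fin n → ℕ)
    (hp : ∀ s', AgreeOff A s s' → ∀ x y : Fin n, G.Adj x y → s'.arr 0 (s'.var 3) = x →
      s'.arr 1 (s'.var 3) = y → (b.holds s' ↔ p x y) ∧ e.eval s' = f x y) :
    Runs s (edgePass A b e) (M * (b.cost + e.cost + 11) + 6) fun s' => AgreeOff A s s' ∧
      ∀ x : Fin n, (∃ y, G.Adj x y ∧ p x y ∧ s'.arr A x = f x y) ∨
        ((∀ y, G.Adj x y → ¬ p x y) ∧ s'.arr A x = s.arr A x) := by
  refine (Runs.forBelow (T := b.cost + 1 + (2 + e.cost + 1)) (fun k s' => AgreeOff A s s' ∧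
      ∀ x : Fin n, (∃ y, G.Adj x y ∧ p x y ∧ s'.arr A x = f x y) ∨
        ((∀ j < k, ∀ y : Fin n, s.arr 0 j = x → s.arr 1 j = y → ¬ p x y) ∧
          s'.arr A x = s.arr A x))
    (by omega) hs.var_four ?_ ?_).mono (by rw [show b.cost + 1 + (2 + e.cost + 1) + 7 =
      b.cost + e.cost + 11 by omega]) ?_
  · refine ⟨⟨fun x hx => by simp [hx], fun B _ => rfl⟩, fun x => Or.inr ⟨by simp, rfl⟩⟩
  · rintro k s' hk h3 h4 ⟨hag, hI⟩
    obtain ⟨x, y, hxy, hx, hy⟩ := hs.adj_of_lt k hk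
    have hx' : s'.arr 0 (s'.var 3) = x := by rw [hag.arr 0 (by omega), h3, hx]
    have hy' : s'.arr 1 (s'.var 3) = y := by rw [hag.arr 1 (by omega), h3, hy]
    obtain ⟨hb, he⟩ := hp s' hag x y hxy hx' hy'
    refine Runs.cond (fun hh => Runs.store ?_) (fun hh => (Runs.skip ?_).mono (by omega)
      fun _ h => h)
    · rw [hb] at hh
      refine ⟨h3, h4, ⟨⟨fun z hz => ?_, fun B hB => ?_⟩, fun z => ?_⟩⟩
      · simp [hz, hag.var z hz]
      · simp [RamState.arr_setArr_of_ne _ _ _ _ hB, hag.arr B hB]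
      · simp only [RamState.arr_setVar, RamState.arr_setArr_self, RamExp.eval, hx', he]
        by_cases hzx : z = x
        · subst hzx
          exact Or.inl ⟨y, hxy, hh, by simp⟩
        · have hne : (z : ℕ) ≠ x := fun h => hzx (Fin.ext h)
          rw [Function.update_of_ne hne]
          rcases hI z with h | ⟨h, h'⟩
          · exact Or.inl h
          · refine Or.inr ⟨fun j hj w hw hw' => ?_, h'⟩
            rcases Nat.lt_succ_iff_lt_or_eq.1 hj with hj | rfl
            · exact h j hj w hw hw'
            · exact absurd (hw.symm.trans hx) hne
    · rw [hb] at hh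
      refine ⟨h3, h4, ⟨⟨fun z hz => ?_, fun B hB => ?_⟩, fun z => ?_⟩⟩
      · simp [hz, hag.var z hz]
      · simp [hag.arr B hB]
      · simp only [RamState.arr_setVar]
        rcases hI z with h | ⟨h, h'⟩
        · exact Or.inl h
        · refine Or.inr ⟨fun j hj w hw hw' => ?_, h'⟩
          rcases Nat.lt_succ_iff_lt_or_eq.1 hj with hj | rfl
          · exact h j hj w hw hw'
          · obtain rfl : x = z := Fin.ext (hx.symm.trans hw)
            obtain rfl : y = w := Fin.ext (hy.symm.trans hw')
            exact hh
  · rintro s' ⟨hag, hI⟩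
    refine ⟨hag, fun x => (hI x).imp_right fun ⟨h, h'⟩ => ⟨fun y hxy => ?_, h'⟩⟩
    obtain ⟨j, hj, hx, hy⟩ := hs.exists_of_adj x y hxy
    exact h j hj y hx hy

/-- Mark in the array `A` the first ends of the oriented edges that pass the test. -/
def markPass (A : ℕ) (b : RamTest) : RamProg := edgePass A b (.const 1)

/-- An entry never written is still 0 by `ZeroFrom`, hence unmarked. -/
theorem runs_markPass {G : SimpleGraph (Fin n)} {v : Fin n} {M A : ℕ} {s : RamState} {b : RamTest}
    (hs : HoldsGraph G v M s) (hz : ZeroFrom A s) (hA : 2 ≤ A) {q : Fin n → Prop}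
    {C : ℕ} (hC : b.cost ≤ C) (p : Fin n → Fin n → Prop)
    (hp : ∀ s', AgreeOff A s s' → ∀ x y : Fin n, G.Adj x y → s'.arr 0 (s'.var 3) = x →
      s'.arr 1 (s'.var 3) = y → (b.holds s' ↔ p x y))
    (hq : ∀ x, q x ↔ ∃ y, G.Adj x y ∧ p x y) :
    Runs s (markPass A b) (M * (C + 12) + 6) fun s' =>
      AgreeOff A s s' ∧ HoldsGraph G v M s' ∧ ZeroFrom (A + 1) s' ∧ Marks s' A q := by
  refine (runs_edgePass hs hA p (fun _ _ => 1) fun s' h x y hxy hx hy =>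
    ⟨hp s' h x y hxy hx hy, rfl⟩).mono ?_ ?_
  · exact Nat.add_le_add_right (Nat.mul_le_mul_left _ (by simp only [RamExp.cost]; omega)) _
  · rintro s' ⟨h1, h2⟩
    refine ⟨h1, h1.holdsGraph hs hA, h1.zeroFrom hz, fun x => ?_⟩
    rw [hq x]
    rcases h2 x with ⟨y, hxy, hy, h⟩ | ⟨h, h'⟩
    · exact ⟨fun _ => ⟨y, hxy, hy⟩, fun _ => h⟩
    · rw [h', hz A le_rfl]
      refine ⟨by omega, fun ⟨y, hxy, hy⟩ => absurd hy (h y hxy)⟩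

/-! ### Doubling the edge list -/

/-- Append all edges with their ends exchanged to the edge list. -/
def doubleEdges : RamProg :=
  .seq (.assign 4 (.var 1))
    (forBelow 3 1
      (.seq (.store 0 (.var 4) (.arr 1 (.var 3)))
        (.seq (.store 1 (.var 4) (.arr 0 (.var 3))) (.assign 4 (.succ (.var 4))))))

theorem runs_doubleEdges {G : SimpleGraph (Fin n)} {v : Fin n} {es : List (Fin n × Fin n)}
    (hes : ListsEdges G es) :
    Runs (inputState es v) doubleEdges (es.length * 18 + 8) fun s =>
      HoldsGraph G v (2 * es.length) s ∧ ZeroFrom 2 s := by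
  have hadj : ∀ p ∈ es, G.Adj p.1 p.2 := fun p hp =>
    (hes.2 s(p.1, p.2)).2 (List.mem_map.2 ⟨p, hp, rfl⟩)
  set m := es.length with hm
  refine (Runs.seq (T := 2) (R := fun s => s = (inputState es v).setVar 4 m)
    (T' := m * 18 + 6)
    (Q := fun s => HoldsGraph G v (2 * m) s ∧ ZeroFrom 2 s) (Runs.assign ?_) ?_).mono (by omega)
      fun _ h => h
  · simp [RamExp.eval, inputState, hm]
  rintro _ rfl
  refine (Runs.forBelow (N := m) (T := 11) (fun k s => s.var 0 = n ∧ s.var 2 = v ∧ s.var 4 = m + k ∧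
      ZeroFrom 2 s ∧ (∀ j (hj : j < m), s.arr 0 j = es[j].1 ∧ s.arr 1 j = es[j].2) ∧
      ∀ j (hj : j < m), j < k → s.arr 0 (m + j) = es[j].2 ∧ s.arr 1 (m + j) = es[j].1)
      (by omega) ?_ ?_ ?_).mono (by omega) ?_
  · simp [inputState, hm]
  · refine ⟨by simp [inputState], by simp [inputState], by simp, ?_, ?_, by simp⟩
    · intro B hB i
      have h0 : B ≠ 0 := by omega
      have h1 : B ≠ 1 := by omega
      simp [inputState, h0, h1]
    · intro j hj
      simp [inputState, List.getD_eq_getElem?_getD, List.getElem?_eq_getElem (hm ▸ hj)]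
  · rintro k s hk h3 h1 ⟨hv0, hv2, hv4, hz, hlo, hhi⟩
    refine (Runs.seq (T := 4) (T' := 7) (R := fun s' => s' = s.setArr 0 (m + k) es[k].2)
      (Runs.store ?_) ?_).mono (by omega) fun _ h => h
    · simp [RamExp.eval, hv4, h3, (hlo k hk).2]
    rintro _ rfl
    refine (Runs.seq (T := 4) (T' := 3)
      (R := fun s' => s' = (s.setArr 0 (m + k) es[k].2).setArr 1 (m + k) es[k].1)
      (Runs.store ?_) (fun s' hs' => Runs.assign ?_)).mono (by omega) fun _ h => h
    -- The slot just written lies in the upper half, so the original edge `k` can still be read.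
    · have : k ≠ m + k := by omega
      simp only [RamExp.eval, RamState.var_setArr, hv4, h3, RamState.arr_setArr_self,
        Function.update_of_ne this, (hlo k hk).1]
    subst hs'
    have e0 : ((s.setArr 0 (m + k) es[k].2).setArr 1 (m + k) es[k].1).arr 0 =
        Function.update (s.arr 0) (m + k) es[k].2 := by
      simp [RamState.arr_setArr]
    have e1 : ((s.setArr 0 (m + k) es[k].2).setArr 1 (m + k) es[k].1).arr 1 =
        Function.update (s.arr 1) (m + k) es[k].1 := by
      simp [RamState.arr_setArr]
    refine ⟨by simp [h3], by simp [h1], by simp [hv0], by simp [hv2],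
      by simp [RamExp.eval, hv4]; omega, ?_, ?_, ?_⟩
    · intro B hB i
      have h0 : B ≠ 0 := by omega
      have h1 : B ≠ 1 := by omega
      simp [RamState.arr_setArr, h0, h1, hz B hB i]
    · intro j hj
      have : j ≠ m + k := by omega
      simp only [RamState.arr_setVar, e0, e1, Function.update_of_ne this]
      exact hlo j hj
    · intro j hj hjk
      simp only [RamState.arr_setVar, e0, e1]
      by_cases hjk' : j = k
      · subst hjk'
        simp
      · have : m + j ≠ m + k := by omega
        simp only [Function.update_of_ne this]
        exact hhi j hj (by omega)
  · rintro s ⟨hv0, hv2, hv4, hz, hlo, hhi⟩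
    refine ⟨⟨hv0, hv2, by omega, ?_, ?_⟩, hz⟩
    · intro j hj
      by_cases hjm : j < m
      · exact ⟨_, _, hadj _ (List.getElem_mem _), hlo j hjm⟩
      · obtain ⟨i, rfl⟩ := Nat.exists_eq_add_of_le (not_lt.1 hjm)
        exact ⟨_, _, (hadj _ (List.getElem_mem _)).symm, hhi i (by omega) (by omega)⟩
    · intro a b hab
      obtain ⟨p, hp, he⟩ := List.mem_map.1 ((hes.2 s(a, b)).1 hab)
      obtain ⟨j, hj, rfl⟩ := List.mem_iff_getElem.1 hp
      rcases Sym2.eq_iff.1 he with ⟨h1, h2⟩ | ⟨h1, h2⟩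
      · exact ⟨j, by omega, by rw [(hlo j hj).1, h1], by rw [(hlo j hj).2, h2]⟩
      · exact ⟨m + j, by omega, by rw [(hhi j hj hj).1, h2], by rw [(hhi j hj hj).2, h1]⟩

end Passes

/-! ### Computing the layers -/

section Preparation

variable {n : ℕ}

/-- The first end of the current edge. -/
def fstEnd : RamExp := .arr 0 (.var 3)

/-- The second end of the current edge. -/
def sndEnd : RamExp := .arr 1 (.var 3)

/-- The entry of the array `A` at `e` is 1. -/
def isOne (A : ℕ) (e : RamExp) : RamTest := .eq (.arr A e) (.const 1)

theorem isOne_holds {s : RamState} {A : ℕ} {e : RamExp} {p : Fin n → Prop} (hp : Marks s A p)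
    {u : Fin n} (hu : e.eval s = u) : (isOne A e).holds s ↔ p u := by
  simp only [isOne, RamTest.holds, RamExp.eval, hu]
  exact hp u

/-- Both ends of the current edge are marked in the array 2. -/
def bothNear : RamTest := .and (isOne 2 fstEnd) (isOne 2 sndEnd)

/-- Compute the layers around `v`, and the properties of its neighbours. -/
def prepare : RamProg :=
  .seq doubleEdges <|
  .seq (markPass 2 (.eq sndEnd (.var 2))) <|
  .seq (markPass 3 (.and (isOne 2 sndEnd) (.and (.not (.eq fstEnd (.var 2)))
    (.not (isOne 2 fstEnd))))) <|
  .seq (markPass 4 (.and (isOne 2 fstEnd) (.and (.not (.eq sndEnd (.var 2)))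
    (.not (isOne 2 sndEnd))))) <|
  .seq (markPass 5 (.and (isOne 3 fstEnd) (.and (.not (isOne 3 sndEnd))
    (.not (isOne 2 sndEnd))))) <|
  .seq (markPass 6 (.and (isOne 2 fstEnd) (.and (isOne 3 sndEnd) (.not (isOne 5 sndEnd))))) <|
  .seq (markPass 7 (.and bothNear (.and (.not (isOne 6 sndEnd)) (.lt sndEnd fstEnd)))) <|
  .seq (markPass 8 (.and bothNear (.not (isOne 4 sndEnd)))) <|
  edgePass 9 bothNear (.succ sndEnd)

/-- What the output phase needs to know about the memory. -/
structure IsPrepared (G : SimpleGraph (Fin n)) (v : Fin n) (s : RamState) : Prop where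
  var_zero : s.var 0 = n
  var_two : s.var 2 = v
  adj : Marks s 2 (G.Adj v)
  hasPrivate : Marks s 4 (HasPrivate G v)
  blocked : Marks s 6 (IsBlocked G v)
  beaten : Marks s 7 (IsBeaten G v)
  stuck : Marks s 8 (IsStuck G v)
  mate : ∀ x y : Fin n, s.arr 9 x = y + 1 ↔ IsMate G v x y

theorem runs_prepare {G : SimpleGraph (Fin n)} (hG : ShortCycleFree G) {v : Fin n}
    {es : List (Fin n × Fin n)} (hes : ListsEdges G es) :
    Runs (inputState es v) prepare (1000 * (es.length + 1)) (IsPrepared G v) := by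
  set M := 2 * es.length with hM
  -- Seven marking passes, with 40 as a common bound for the costs of their tests, and the pass
  -- recording mates.
  refine Runs.mono (T := es.length * 18 + 8 + ((M * (40 + 12) + 6) + ((M * (40 + 12) + 6) +
    ((M * (40 + 12) + 6) + ((M * (40 + 12) + 6) + ((M * (40 + 12) + 6) + ((M * (40 + 12) + 6) +
    ((M * (40 + 12) + 6) + (M * (bothNear.cost + sndEnd.succ.cost + 11) + 6)))))))))
    (Runs.seq (runs_doubleEdges hes) ?_)
    (by
      have : bothNear.cost + sndEnd.succ.cost + 11 = 25 := by
        simp [bothNear, isOne, fstEnd, sndEnd, RamTest.cost, RamExp.cost]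
      rw [this]; omega) fun _ h => h
  rintro s ⟨hs, hz⟩
  refine Runs.seq (runs_markPass hs hz (by omega) (q := G.Adj v)
    (C := 40) (by decide)
    (fun _ y => y = v) ?_ ?_) ?_
  · intro s' h x y hxy hx hy
    simp only [RamTest.holds, sndEnd, RamExp.eval, hy, h.var 2 (by omega), hs.var_two, Fin.ext_iff]
  · simp [G.adj_comm]
  rintro s₂ ⟨-, hs, hz, m2⟩
  refine Runs.seq (runs_markPass hs hz (by omega) (q := InSecond G v)
    (C := 40) (by decide)
    (fun x y => G.Adj v y ∧ x ≠ v ∧ ¬ G.Adj v x) ?_ ?_) ?_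
  · intro s' h x y hxy hx hy
    have m2 := h.marks m2 (by omega)
    simp only [RamTest.holds, isOne_holds m2 (e := fstEnd) hx, isOne_holds m2 (e := sndEnd) hy]
    simp only [fstEnd, RamExp.eval, hx, h.var 2 (by omega), hs.var_two, Fin.ext_iff, ne_eq]
  · intro x
    simp only [InSecond, G.adj_comm _ x]
    tauto
  rintro s₃ ⟨hag, hs, hz, m3⟩
  replace m2 := hag.marks m2 (by omega)
  refine Runs.seq (runs_markPass hs hz (by omega) (q := HasPrivate G v)
    (C := 40) (by decide)
    (fun x y => G.Adj v x ∧ y ≠ v ∧ ¬ G.Adj v y) ?_ ?_) ?_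
  · intro s' h x y hxy hx hy
    have m2 := h.marks m2 (by omega)
    simp only [RamTest.holds, isOne_holds m2 (e := fstEnd) hx, isOne_holds m2 (e := sndEnd) hy]
    simp only [sndEnd, RamExp.eval, hy, h.var 2 (by omega), hs.var_two, Fin.ext_iff, ne_eq]
  · intro x
    unfold HasPrivate
    tauto
  rintro s₄ ⟨hag, hs, hz, m4⟩
  replace m2 := hag.marks m2 (by omega)
  replace m3 := hag.marks m3 (by omega)
  refine Runs.seq (runs_markPass hs hz (by omega) (q := HasThird G v)
    (C := 40) (by decide)
    (fun x y => InSecond G v x ∧ ¬ InSecond G v y ∧ ¬ G.Adj v y) ?_ ?_) ?_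
  · intro s' h x y hxy hx hy
    have m2 := h.marks m2 (by omega)
    have m3 := h.marks m3 (by omega)
    simp only [RamTest.holds, isOne_holds m3 (e := fstEnd) hx, isOne_holds m2 (e := sndEnd) hy,
      isOne_holds m3 (e := sndEnd) hy]
  · intro x
    unfold HasThird
    tauto
  rintro s₅ ⟨hag, hs, hz, m5⟩
  replace m2 := hag.marks m2 (by omega)
  replace m3 := hag.marks m3 (by omega)
  replace m4 := hag.marks m4 (by omega)
  refine Runs.seq (runs_markPass hs hz (by omega) (q := IsBlocked G v)
    (C := 40) (by decide)
    (fun x y => G.Adj v x ∧ InSecond G v y ∧ ¬ HasThird G v y) ?_ ?_) ?_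
  · intro s' h x y hxy hx hy
    have m2 := h.marks m2 (by omega)
    have m3 := h.marks m3 (by omega)
    have m5 := h.marks m5 (by omega)
    simp only [RamTest.holds, isOne_holds m2 (e := fstEnd) hx, isOne_holds m3 (e := sndEnd) hy,
      isOne_holds m5 (e := sndEnd) hy]
  · intro x
    unfold IsBlocked
    tauto
  rintro s₆ ⟨hag, hs, hz, m6⟩
  replace m2 := hag.marks m2 (by omega)
  replace m4 := hag.marks m4 (by omega)
  refine Runs.seq (runs_markPass hs hz (by omega) (q := IsBeaten G v)
    (C := 40) (by decide)
    (fun x y => (G.Adj v x ∧ G.Adj v y) ∧ ¬ IsBlocked G v y ∧ y < x) ?_ ?_) ?_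
  · intro s' h x y hxy hx hy
    have m2 := h.marks m2 (by omega)
    have m6 := h.marks m6 (by omega)
    simp only [RamTest.holds, bothNear, isOne_holds m2 (e := fstEnd) hx,
      isOne_holds m2 (e := sndEnd) hy, isOne_holds m6 (e := sndEnd) hy]
    simp only [fstEnd, sndEnd, RamExp.eval, hx, hy, Fin.lt_def]
  · intro x
    simp only [IsBeaten, IsMate]
    refine exists_congr fun y => ?_
    tauto
  rintro s₇ ⟨hag, hs, hz, m7⟩
  replace m2 := hag.marks m2 (by omega)
  replace m4 := hag.marks m4 (by omega)
  replace m6 := hag.marks m6 (by omega)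
  refine Runs.seq (runs_markPass hs hz (by omega) (q := IsStuck G v)
    (C := 40) (by decide)
    (fun x y => (G.Adj v x ∧ G.Adj v y) ∧ ¬ HasPrivate G v y) ?_ ?_) ?_
  · intro s' h x y hxy hx hy
    have m2 := h.marks m2 (by omega)
    have m4 := h.marks m4 (by omega)
    simp only [RamTest.holds, bothNear, isOne_holds m2 (e := fstEnd) hx,
      isOne_holds m2 (e := sndEnd) hy, isOne_holds m4 (e := sndEnd) hy]
  · intro x
    simp only [IsStuck, IsMate]
    refine exists_congr fun y => ?_
    tauto
  rintro s₈ ⟨hag, hs, hz, m8⟩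
  replace m2 := hag.marks m2 (by omega)
  replace m4 := hag.marks m4 (by omega)
  replace m6 := hag.marks m6 (by omega)
  replace m7 := hag.marks m7 (by omega)
  refine (runs_edgePass hs (by omega) (fun x y => G.Adj v x ∧ G.Adj v y)
    (fun _ y => y + 1) ?_).mono le_rfl ?_
  · intro s' h x y hxy hx hy
    have m2 := h.marks m2 (by omega)
    refine ⟨?_, ?_⟩
    · simp only [RamTest.holds, bothNear, isOne_holds m2 (e := fstEnd) hx,
        isOne_holds m2 (e := sndEnd) hy]
    · simp only [sndEnd, RamExp.eval, hy]
  · rintro s' ⟨hag, h⟩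
    have hs' := hag.holdsGraph hs (by omega)
    refine ⟨hs'.var_zero, hs'.var_two, hag.marks m2 (by omega), hag.marks m4 (by omega),
      hag.marks m6 (by omega), hag.marks m7 (by omega), hag.marks m8 (by omega), fun x y => ?_⟩
    rcases h x with ⟨z, hxz, ⟨hx, hz'⟩, e⟩ | ⟨h, e⟩
    · have hm : IsMate G v x z := ⟨hx, hz', hxz⟩
      rw [e]
      -- Whichever edge wrote the entry last, uniqueness of the mate determines its value.
      refine ⟨fun e' => ?_, fun hy => by rw [hG.mate_unique hm hy]⟩
      obtain rfl : z = y := Fin.ext (by omega)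
      exact hm
    -- Mates are stored shifted by one, so the default 0 means that there is none.
    · rw [e, hz 9 (by omega)]
      exact ⟨fun e' => by omega, fun hy => absurd ⟨hy.1, hy.2.1⟩ (h y hy.2.2)⟩

end Preparation

/-! ### Writing the output -/

section Output

variable {n : ℕ}

/-- The memory holds the list `F` of sets, and the beginning `D` of a further set; the register 5
holds the length of `F`, the register 8 the number of entries of array 1 in use. -/
structure IsWriting (F : List (Finset (Fin n))) (D : Finset ℕ) (s : RamState) : Prop where
  length : s.var 5 = F.length
  le : s.arr 0 (s.var 5) ≤ s.var 8
  current : D = (Finset.Ico (s.arr 0 (s.var 5)) (s.var 8)).image (s.arr 1)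
  finished : ∀ (i : ℕ) (hi : i < F.length), s.arr 0 i ≤ s.arr 0 (i + 1) ∧
    s.arr 0 (i + 1) ≤ s.arr 0 (s.var 5) ∧
    (F[i]'hi).image (fun u : Fin n => (u : ℕ)) =
      (Finset.Ico (s.arr 0 i) (s.arr 0 (i + 1))).image (s.arr 1)

theorem image_Ico_update {f : ℕ → ℕ} {a b p z : ℕ} (h : b ≤ p) :
    (Finset.Ico a b).image (Function.update f p z) = (Finset.Ico a b).image f := by
  refine Finset.image_congr fun x hx => ?_
  have := (Finset.mem_Ico.1 hx).2
  exact Function.update_of_ne (by omega) _ _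

theorem IsWriting.push {F : List (Finset (Fin n))} {D : Finset ℕ} {s s' : RamState}
    (h : IsWriting F D s) (z : ℕ) (h5 : s'.var 5 = s.var 5) (h8 : s'.var 8 = s.var 8 + 1)
    (h0 : s'.arr 0 = s.arr 0) (h1 : s'.arr 1 = Function.update (s.arr 1) (s.var 8) z) :
    IsWriting F (insert z D) s' := by
  have hle := h.le
  refine ⟨h5.trans h.length, by rw [h0, h5, h8]; omega, ?_, fun i hi => ?_⟩
  · rw [h0, h5, h8, h1, ← Finset.insert_Ico_right_eq_Ico_add_one hle, Finset.image_insert, Function.update_self,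
      image_Ico_update le_rfl, h.current]
  · obtain ⟨e1, e2, e3⟩ := h.finished i hi
    rw [h0, h5, h1, image_Ico_update (e2.trans hle)]
    exact ⟨e1, e2, e3⟩

theorem IsWriting.close {F : List (Finset (Fin n))} {D : Finset (Fin n)} {s s' : RamState}
    (h : IsWriting F (D.image fun u : Fin n => (u : ℕ)) s) (h5 : s'.var 5 = s.var 5 + 1)
    (h8 : s'.var 8 = s.var 8) (h1 : s'.arr 1 = s.arr 1)
    (h0 : s'.arr 0 = Function.update (s.arr 0) (s.var 5 + 1) (s.var 8)) :
    IsWriting (F ++ [D]) ∅ s' := by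
  have hlen := h.length
  have hnew : s'.arr 0 (s'.var 5) = s.var 8 := by rw [h0, h5, Function.update_self]
  have hold : ∀ i ≤ F.length, s'.arr 0 i = s.arr 0 i := fun i hi => by
    rw [h0]; exact Function.update_of_ne (by omega) _ _
  refine ⟨by simp [h5, hlen], by rw [hnew, h8], by rw [hnew, h8]; simp, fun i hi => ?_⟩
  rw [hnew, h1]
  rw [List.length_append, List.length_singleton] at hi
  by_cases hiF : i < F.length
  · rw [hold i (by omega), hold (i + 1) (by omega), List.getElem_append_left hiF]
    obtain ⟨e1, e2, e3⟩ := h.finished i hiF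
    exact ⟨e1, e2.trans h.le, e3⟩
  · obtain rfl : i = F.length := by omega
    have hi1 : s'.arr 0 (F.length + 1) = s.var 8 := by rw [← hnew, h5, hlen]
    rw [hold _ le_rfl, hi1, List.getElem_append_right le_rfl]
    have hle := h.le
    have hcur := h.current
    rw [hlen] at hle hcur
    exact ⟨hle, le_rfl, by simpa using hcur⟩

theorem IsWriting.congr {F : List (Finset (Fin n))} {D : Finset ℕ} {s s' : RamState}
    (h : IsWriting F D s) (h5 : s'.var 5 = s.var 5) (h8 : s'.var 8 = s.var 8)
    (h0 : s'.arr 0 = s.arr 0) (h1 : s'.arr 1 = s.arr 1) : IsWriting F D s' := by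
  obtain ⟨e1, e2, e3, e4⟩ := h
  refine ⟨?_, ?_, ?_, ?_⟩ <;> (try rw [h8]) <;> (try rw [h0]) <;> rw [h5] <;> (try rw [h1]) <;>
    assumption

theorem IsWriting.holdsOutput {F : List (Finset (Fin n))} {D : Finset ℕ} {s : RamState}
    (h : IsWriting F D s) : HoldsOutput (s.setVar 0 (s.var 5)) F := by
  refine ⟨by simp [h.length], fun i hi => ?_⟩
  obtain ⟨e1, e2, e3⟩ := h.finished i hi
  exact ⟨e1, e3⟩

/-- Write, for every `u`, the set of all `z` such that the test holds with `u` and `z` in the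
registers 6 and 3. -/
def writeSets (b : RamTest) : RamProg :=
  .seq (.assign 5 (.const 0)) <|
  .seq (.assign 8 (.const 0)) <|
  .seq (.store 0 (.const 0) (.const 0)) <|
  .seq (forBelow 6 0
    (.seq
      (forBelow 3 0
        (.cond b (.seq (.store 1 (.var 8) (.var 3)) (.assign 8 (.succ (.var 8)))) .skip))
      (.cond (.lt (.arr 0 (.var 5)) (.var 8))
        (.seq (.assign 5 (.succ (.var 5))) (.store 0 (.var 5) (.var 8))) .skip))) <|
  .assign 0 (.var 5)

open Classical in
/-- The non-empty sets among `W 0, …, W (k - 1)`. -/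
noncomputable def nonemptySets (W : ℕ → Finset (Fin n)) (k : ℕ) : List (Finset (Fin n)) :=
  ((List.range k).map W).filter fun Y => Y.Nonempty

theorem nonemptySets_succ_of_nonempty {W : ℕ → Finset (Fin n)} {k : ℕ} (h : (W k).Nonempty) :
    nonemptySets W (k + 1) = nonemptySets W k ++ [W k] := by
  simp [nonemptySets, List.range_succ, h]

theorem nonemptySets_succ_of_empty {W : ℕ → Finset (Fin n)} {k : ℕ} (h : W k = ∅) :
    nonemptySets W (k + 1) = nonemptySets W k := by
  simp [nonemptySets, List.range_succ, h]

/-- The parts of the memory that the output phase reads only. -/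
structure SameInput (s s' : RamState) : Prop where
  var_zero : s'.var 0 = s.var 0
  var_two : s'.var 2 = s.var 2
  arr : ∀ A, 2 ≤ A → s'.arr A = s.arr A

open Classical in
-- The output overwrites the edge list in the arrays 0 and 1. This is safe because the test may
-- depend only on arrays from 2 on and on registers the loops preserve or control. A set is closed
-- only if entries were written since the last pointer, which drops the empty ones.
theorem runs_writeSets {s : RamState} {b : RamTest} (W : ℕ → Finset (Fin n)) (h0 : s.var 0 = n)
    (hb : ∀ s' u (z : Fin n), SameInput s s' → s'.var 6 = u → u < n → s'.var 3 = z →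
      (b.holds s' ↔ z ∈ W u)) :
    Runs s (writeSets b) (n * (n * (b.cost + 14) + 27) + 15)
      fun s' => HoldsOutput s' (nonemptySets W n) := by
  -- Invariant of the inner loop: the elements of `W u` below the counter have been written.
  set below : ℕ → ℕ → Finset ℕ := fun u k =>
    ((W u).filter fun z : Fin n => (z : ℕ) < k).image fun z : Fin n => (z : ℕ) with hbelow
  have below_zero : ∀ u, below u 0 = ∅ := by simp [hbelow]
  have below_n : ∀ u, below u n = (W u).image fun z : Fin n => (z : ℕ) := by simp [hbelow]
  have below_succ : ∀ u (z : Fin n), below u (z + 1) =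
      if z ∈ W u then insert (z : ℕ) (below u z) else below u z := by
    intro u z
    ext a
    split_ifs with hz
    · simp only [hbelow, Finset.mem_insert, Finset.mem_image, Finset.mem_filter]
      constructor
      · rintro ⟨y, ⟨hy, hlt⟩, rfl⟩
        rcases Nat.lt_succ_iff_lt_or_eq.1 hlt with h | h
        · exact Or.inr ⟨y, ⟨hy, h⟩, rfl⟩
        · exact Or.inl h
      · rintro (rfl | ⟨y, ⟨hy, hlt⟩, rfl⟩)
        · exact ⟨z, ⟨hz, by omega⟩, rfl⟩
        · exact ⟨y, ⟨hy, by omega⟩, rfl⟩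
    · simp only [hbelow, Finset.mem_image, Finset.mem_filter]
      refine exists_congr fun y => and_congr_left fun _ => and_congr_right fun hy => ?_
      have : (y : ℕ) ≠ z := fun e => hz (Fin.ext e ▸ hy)
      omega
  set C := n * (b.cost + 1 + 6 + 7) + 6 with hC
  refine Runs.mono (T := 2 + (2 + (3 + ((n * (C + 11 + 7) + 6) + 2))))
    (Runs.seq (R := fun s' => s' = s.setVar 5 0) (Runs.assign (e := .const 0) rfl) ?_) ?_
    fun _ h => h
  swap
  · rw [hC, show n * (b.cost + 1 + 6 + 7) + 6 + 11 + 7 = n * (b.cost + 14) + 24 by ring]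
    have : n * (n * (b.cost + 14) + 24) ≤ n * (n * (b.cost + 14) + 27) :=
      Nat.mul_le_mul_left _ (by omega)
    omega
  rintro _ rfl
  refine Runs.seq (R := fun s' => s' = (s.setVar 5 0).setVar 8 0)
    (Runs.assign (e := .const 0) rfl) ?_
  rintro _ rfl
  refine Runs.seq (R := fun s' => s' = ((s.setVar 5 0).setVar 8 0).setArr 0 0 0)
    (Runs.store (i := .const 0) (e := .const 0) rfl) ?_
  rintro _ rfl
  refine Runs.seq (R := fun s' => SameInput s s' ∧ IsWriting (nonemptySets W n) ∅ s')
    (Runs.forBelow (T := C + 11)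
      (fun k s' => SameInput s s' ∧ IsWriting (nonemptySets W k) ∅ s')
      (by omega) (by simp [h0]) ?_ ?_) ?_
  · refine ⟨⟨by simp, by simp, fun A hA => ?_⟩, ⟨by simp [nonemptySets], by simp, by simp, ?_⟩⟩
    · have : A ≠ 0 := by omega
      simp [RamState.arr_setArr, this]
    · simp [nonemptySets]
  · rintro u s₁ hu h6 h0' ⟨hsame, hw⟩
    refine Runs.seq (T := C) (T' := 11) (R := fun s' => s'.var 6 = u ∧ s'.var 0 = n ∧ SameInput s s' ∧
        IsWriting (nonemptySets W u) ((W u).image fun z : Fin n => (z : ℕ)) s')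
      ((Runs.forBelow (T := b.cost + 1 + 6) (fun k s' => s'.var 6 = u ∧ s'.var 0 = n ∧ SameInput s s' ∧
        IsWriting (nonemptySets W u) (below u k) s') (by omega) h0' ?_ ?_).mono le_rfl ?_) ?_
    · refine ⟨by simp [h6], by simp [h0'], ⟨?_, ?_, hsame.arr⟩, ?_⟩
      · simp [hsame.var_zero]
      · simp [hsame.var_two]
      · rw [below_zero]
        exact hw.congr (by simp) (by simp) rfl rfl
    · rintro z s₂ hz h3 - ⟨h6, h0, hsame, hw⟩
      have hbz := hb s₂ u ⟨z, hz⟩ hsame h6 hu h3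
      have hsucc := below_succ u ⟨z, hz⟩
      refine Runs.cond (T := 6) (fun hh => ?_) (fun hh => ?_)
      · rw [hbz] at hh
        refine Runs.seq (T := 3) (T' := 3) (R := fun s' => s' = s₂.setArr 1 (s₂.var 8) z)
          (Runs.store (by simp [RamExp.eval, h3])) ?_
        rintro _ rfl
        refine Runs.assign ⟨by simp [h3], by simp [h0], by simp [h6], by simp [h0],
          ⟨?_, ?_, fun A hA => ?_⟩, ?_⟩
        · simp [hsame.var_zero]
        · simp [hsame.var_two]
        · have : A ≠ 1 := by omega
          simp [RamState.arr_setArr, this, hsame.arr A hA]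
        · simp only [hh, if_true] at hsucc
          rw [hsucc]
          exact hw.push z (by simp) (by simp [RamExp.eval]) (by simp [RamState.arr_setArr])
            (by simp)
      · rw [hbz] at hh
        refine (Runs.skip ⟨by simp [h3], by simp [h0], by simp [h6], by simp [h0],
          ⟨?_, ?_, fun A hA => ?_⟩, ?_⟩).mono (by omega) fun _ h => h
        · simp [hsame.var_zero]
        · simp [hsame.var_two]
        · exact hsame.arr A hA
        · simp only [hh, if_false] at hsucc
          rw [hsucc]
          exact hw.congr (by simp) (by simp) rfl rfl
    · rintro s' ⟨h1, h2, h3, h4⟩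
      rw [below_n] at h4
      exact ⟨h1, h2, h3, h4⟩
    · rintro s₂ ⟨h6, h0, hsame, hw⟩
      refine Runs.cond (T := 6) (fun hh => ?_) (fun hh => ?_)
      · simp only [RamTest.holds, RamExp.eval] at hh
        have hne : (W u).Nonempty := by
          rw [← Finset.image_nonempty (f := fun z : Fin n => (z : ℕ)), hw.current]
          simpa using hh
        refine Runs.seq (T := 3) (T' := 3) (R := fun s' => s' = s₂.setVar 5 (s₂.var 5 + 1))
          (Runs.assign (by simp [RamExp.eval])) ?_
        rintro _ rfl
        refine Runs.store ⟨by simp [h6], by simp [h0], ⟨?_, ?_, fun A hA => ?_⟩, ?_⟩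
        · simp [hsame.var_zero]
        · simp [hsame.var_two]
        · have : A ≠ 0 := by omega
          simp [RamState.arr_setArr, this, hsame.arr A hA]
        · rw [nonemptySets_succ_of_nonempty hne]
          exact hw.close (by simp) (by simp) (by simp [RamState.arr_setArr]) (by simp [RamExp.eval])
      · simp only [RamTest.holds, RamExp.eval] at hh
        have hemp : W u = ∅ := by
          have := hw.current
          rw [Finset.Ico_eq_empty hh, Finset.image_empty, Finset.image_eq_empty] at this
          exact this
        refine (Runs.skip ⟨by simp [h6], by simp [h0], ⟨?_, ?_, fun A hA => ?_⟩, ?_⟩).mono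
          (by omega) fun _ h => h
        · simp [hsame.var_zero]
        · simp [hsame.var_two]
        · exact hsame.arr A hA
        · rw [nonemptySets_succ_of_empty hemp]
          rw [hemp, Finset.image_empty] at hw
          exact hw.congr (by simp) (by simp) rfl rfl
  · rintro s' ⟨-, hw⟩
    exact Runs.assign hw.holdsOutput

end Output

/-! ### The algorithm -/

section Algorithm

/-- Disjunction of tests. -/
def RamTest.or (a b : RamTest) : RamTest := .not (.and (.not a) (.not b))

@[simp] theorem RamTest.or_holds {s : RamState} {a b : RamTest} :
    (a.or b).holds s ↔ a.holds s ∨ b.holds s := by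
  simp only [RamTest.or, RamTest.holds]
  tauto

/-- The vertex in the register `x` is in the base set. -/
def baseTest (x : ℕ) : RamTest :=
  .and (isOne 2 (.var x)) (.and (.not (isOne 6 (.var x))) (.not (isOne 7 (.var x))))

/-- The vertex in the register 3 is in the set that the vertex in the register 6 contributes. -/
def memberTest : RamTest :=
  .or (.and (.eq (.var 6) (.var 2)) (baseTest 3)) <|
  .or (.and (baseTest 6) (.and (isOne 4 (.var 6)) (.and (.not (isOne 8 (.var 6)))
    (.and (baseTest 3) (.not (.eq (.var 3) (.var 6))))))) <|
  .and (isOne 2 (.var 6)) (.and (.not (isOne 6 (.var 6))) (.and (isOne 7 (.var 6))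
    (.or (.eq (.var 3) (.var 6))
      (.and (baseTest 3) (.not (.eq (.arr 9 (.var 6)) (.succ (.var 3))))))))

variable {n : ℕ} {G : SimpleGraph (Fin n)} {v : Fin n} {s : RamState}

theorem IsPrepared.baseTest_holds (h : IsPrepared G v s) {x : ℕ} {u : Fin n} (hu : s.var x = u) :
    (baseTest x).holds s ↔ InBase G v u := by
  simp only [baseTest, RamTest.holds, isOne_holds h.adj (e := .var x) hu,
    isOne_holds h.blocked (e := .var x) hu, isOne_holds h.beaten (e := .var x) hu, InBase]

theorem IsPrepared.memberTest_holds (h : IsPrepared G v s) {u z : Fin n} (hu : s.var 6 = u)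
    (hz : s.var 3 = z) : memberTest.holds s ↔ InMember G v u z := by
  have hm : s.arr 9 u = z + 1 ↔ IsMate G v u z := h.mate u z
  simp only [memberTest, RamTest.or_holds, RamTest.holds, h.baseTest_holds hu, h.baseTest_holds hz,
    isOne_holds h.adj (e := .var 6) hu, isOne_holds h.hasPrivate (e := .var 6) hu,
    isOne_holds h.blocked (e := .var 6) hu, isOne_holds h.beaten (e := .var 6) hu,
    isOne_holds h.stuck (e := .var 6) hu, RamExp.eval, hu, hz, h.var_two, hm, InMember,
    Fin.ext_iff, ne_eq]

theorem IsPrepared.of_sameInput (h : IsPrepared G v s) {s' : RamState} (hs : SameInput s s') :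
    IsPrepared G v s' := by
  obtain ⟨h0, h2, h3, h4, h5, h6, h7, h8⟩ := h
  refine ⟨hs.var_zero.trans h0, hs.var_two.trans h2, ?_, ?_, ?_, ?_, ?_, ?_⟩ <;>
    first | (intro u; rw [hs.arr _ (by omega)]; apply_assumption)

variable (G v) in
/-- The set that the vertex with number `u` contributes. -/
noncomputable def memberSetOf (u : ℕ) : Finset (Fin n) :=
  if h : u < n then memberSet G v ⟨u, h⟩ else ∅

theorem mem_nonemptySets_memberSetOf {Y : Finset (Fin n)} :
    Y ∈ nonemptySets (memberSetOf G v) n ↔ Y ∈ memberFamily G v := by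
  simp only [nonemptySets, List.mem_filter, List.mem_map, List.mem_range, decide_eq_true_eq,
    memberFamily, Set.mem_ofPred_eq]
  constructor
  · rintro ⟨⟨u, hu, rfl⟩, hne⟩
    exact ⟨hne, ⟨u, hu⟩, by simp [memberSetOf, hu]⟩
  · rintro ⟨hne, u, rfl⟩
    exact ⟨⟨u, u.2, by simp [memberSetOf]⟩, hne⟩

theorem length_nonemptySets_le (W : ℕ → Finset (Fin n)) (k : ℕ) :
    (nonemptySets W k).length ≤ k :=
  (List.length_filter_le _ _).trans (by simp)

theorem runs_algorithm (hG : ShortCycleFree G) {es : List (Fin n × Fin n)} (hes : ListsEdges G es) :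
    Runs (inputState es v) (.seq prepare (writeSets memberTest))
      (1000 * (es.length + 1) + (n * (n * (memberTest.cost + 14) + 27) + 15))
      fun s => HoldsOutput s (nonemptySets (memberSetOf G v) n) := by
  refine Runs.seq (runs_prepare hG hes) fun s hs => ?_
  refine runs_writeSets _ hs.var_zero fun s' u z hsame h6 hu h3 => ?_
  rw [(hs.of_sameInput hsame).memberTest_holds (u := ⟨u, hu⟩) h6 h3]
  simp [memberSetOf, hu]

theorem ListsEdges.length_eq {es : List (Fin n × Fin n)} (hes : ListsEdges G es) :
    es.length = G.edgeSet.ncard := by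
  classical
  have : G.edgeSet = ((es.map fun p => s(p.1, p.2)).toFinset : Set (Sym2 (Fin n))) := by
    ext e
    simpa using hes.2 e
  rw [this, Set.ncard_coe_finset, List.toFinset_card_of_nodup hes.1, List.length_map]

end Algorithm

theorem theorem4 :
    ∃ (P : RamProg) (c : ℕ),
      ∀ (n : ℕ) (G : SimpleGraph (Fin n)) (v : Fin n) (es : List (Fin n × Fin n)),
        ListsEdges G es →
        (SimpleGraph.cycleGraph 4).Free G → (SimpleGraph.cycleGraph 5).Free G →
        (SimpleGraph.cycleGraph 6).Free G → (SimpleGraph.cycleGraph 7).Free G →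
        ∃ (t : ℕ) (s : RamState) (F : List (Finset (Fin n))),
          RamExec P (inputState es v) t s ∧
          t ≤ c * (n ^ 2 * (n + G.edgeSet.ncard)) ∧
          HoldsOutput s F ∧
          F.length ≤ n ∧
          (∀ Y ∈ F, IsGenerating G {v} Y) ∧
          Submodule.span ℝ (constraintForm '' {B | ∃ Y ∈ F, B = ({v}, Y)}) =
            Submodule.span ℝ (constraintForm '' generatingAt G v) ∧
          solutionSpace {B | ∃ Y ∈ F, B = ({v}, Y)} = spaceL G v := by
  -- The constant is `(K + 14) + 2042` with `K` the cost of the test: the first part pays for the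
  -- `n²` tests, the second for the terms linear in `n` and `m`, with room to spare.
  refine ⟨.seq prepare (writeSets memberTest), 2000 + (memberTest.cost + 56),
    fun n G v es hes h4 h5 h6 h7 => ?_⟩
  have hG : ShortCycleFree G := ⟨h4, h5, h6, h7⟩
  obtain ⟨t, s, hrun, ht, hout⟩ := runs_algorithm (v := v) hG hes
  have hspan : Submodule.span ℝ (constraintForm ''
      {B | ∃ Y ∈ nonemptySets (memberSetOf G v) n, B = ({v}, Y)}) =
        Submodule.span ℝ (constraintForm '' generatingAt G v) := by
    simpa only [mem_nonemptySets_memberSetOf] using span_memberFamily hG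
  refine ⟨t, s, _, hrun, ht.trans ?_, hout, length_nonemptySets_le _ _, fun Y hY =>
    isGenerating_of_mem_memberFamily hG (mem_nonemptySets_memberSetOf.1 hY), hspan,
    solutionSpace_eq_of_span_eq hspan⟩
  rw [← hes.length_eq]
  have hn : 1 ≤ n := Fin.pos v
  generalize memberTest.cost = K
  generalize es.length = m
  set X := n ^ 2 * (n + m) with hX
  have hX1 : n * n ≤ X := by
    rw [hX, sq]
    exact Nat.le_mul_of_pos_right _ (by omega)
  have hX2 : n + m ≤ X := Nat.le_mul_of_pos_left _ (by positivity)
  have hX3 : n * n * (K + 14) ≤ X * (K + 14) := Nat.mul_le_mul_right _ hX1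
  have hL : n * (n * (K + 14) + 27) = n * n * (K + 14) + 27 * n := by ring
  have hR : (2000 + (K + 56)) * X = X * (K + 14) + 2042 * X := by ring
  omega
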